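/- Let $F$ be a non-archimedean local field, $E/F$ a finite Galois extension, and $\Omega$ a common separable closure, so that the Weil groups satisfy $W_E\subset W_F$. For $K\in\{E,F\}$ let $W_K^s$ ($s\ge -1$) be the upper numbering ramification filtration of $W_K$, and let $W_K^{r+}$ be the closure of $\bigcup_{s>r}W_K^s$ in $W_K$. Let $\varphi_{E/F}(u)=\int_0^u \frac{dt}{(\Gamma_0:\Gamma_t)}$ be the Hasse–Herbrand function of $\Gamma=\mathrm{Gal}(E/F)$ (with the lower numbering) and $\psi_{E/F}$ its inverse. Let $G$ be a connected reductive group over $E$ with complex dual group $G^\vee$, on which $W_E$ acts through a finite quotient of $\mathrm{Gal}(\Omega/E)$ by automorphisms of algebraic groups, and let $M=\mathfrak R_{E/F}\,G$ be its Weil restriction, with dual group $M^\vee=\mathrm{Ind}_{W_E}^{W_F}G^\vee$, the group of maps $f:W_F\to G^\vee$, constant on left cosets of an open subgroup, with $f(hx)={}^h f(x)$ for $h\in W_E$, and with action $({}^g f)(x)=f(xg)$ of $W_F$. (Only this structure is used: $G^\vee$ may be any complex connected reductive group with such an action of $W_E$.) For $(K,H)=(F,M^\vee)$ or $(E,G^\vee)$,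 an L-parameter is a homomorphism $\phi:W_K\times \mathrm{SL}_2(\mathbb C)\to H\rtimes W_K$ over $W_K$ that is continuous, algebraic on $\mathrm{SL}_2(\mathbb C)$, and maps $W_K$ to semisimple elements (no relevance condition is imposed); L-parameters are taken up to conjugation by $H$. Let $[\alpha_\phi]\in \mathrm H^1(W_K,H)$ be the class of the continuous cocycle $\alpha_\phi$ of $W_K$ in the discrete group $H$ given by $\phi(w,1)=(\alpha_\phi(w),w)$, and define the depth of $\phi$ by $$\mathrm{dep}(\phi)=\inf\{r\in\mathbb R_{\ge 0} : [\alpha_\phi]\in \mathrm H^1(W_K/W_K^{r+},H^{W_K^{r+}})\},$$ where $\mathrm H^1(W_K/W_K^{r+},H^{W_K^{r+}})$ is regarded as a subset of $\mathrm H^1(W_K,H)$ by inflation. Let $\mathrm{Sh}$ be the map from L-parameters of $M$ to L-parameters of $G$ induced by the Shapiro isomorphism $\mathrm H^1(W_F,M^\vee)\simeq \mathrm H^1(W_E,G^\vee)$, that is, by restriction to $W_E$ followed by evaluation $f\mapsto f(1)$. Then, for every L-parameter $\phi$ of $M$, $$\mathrm{dep}(\mathrm{Sh}(\phi))=\psi_{E/F}(\mathrm{dep}(\phi)).$$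 In particular, $\phi$ has depth $0$ if and only if $\mathrm{Sh}(\phi)$ has depth $0$. -/

import Mathlib

set_option linter.unusedSectionVars false

open scoped ValuativeRel

noncomputable section

/-! ## Rings of integers and ramification groups

`F` is a non-archimedean local field. All fields occurring (`E`, a separable closure `Ω`, the
finite extensions of `F` or `E` inside `Ω`) are algebraic over `F`, and the ring of integers of such
a field `L` is the integral closure of `𝒪[F]` in `L`. -/

section Ramification

variable (F : Type*) [Field F] [ValuativeRel F]

instance galSMulCommClass (K L : Type*) [Field K] [Field L] [Algebra F K] [Algebra F L]
    [Algebra K L] [IsScalarTower F K L] : SMulCommClass Gal(L/K) 𝒪[F] L where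
  smul_comm σ a x := by
    have h : ∀ y : L, a • y = algebraMap K L (algebraMap F K (a : F)) * y := fun y => by
      rw [← IsScalarTower.algebraMap_apply F K L, ← Algebra.smul_def]; rfl
    rw [h, h, AlgEquiv.smul_def, AlgEquiv.smul_def, map_mul, AlgEquiv.commutes]

/-- The maximal ideal of the ring of integers of an algebraic extension `L` of `F`. (The ring of
integers is a local ring, since `F` is complete; its maximal ideal is its Jacobson radical.) -/
def maxIdeal (L : Type*) [Field L] [Algebra F L] : Ideal (integralClosure 𝒪[F] L) :=
  Ideal.jacobson ⊥

theorem smul_mem_maxIdeal_pow (K L : Type*) [Field K] [Field L] [Algebra F K] [Algebra F L]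
    [Algebra K L] [IsScalarTower F K L] (n : ℕ) (σ : Gal(L/K)) {x : integralClosure 𝒪[F] L}
    (hx : x ∈ maxIdeal F L ^ n) : σ • x ∈ maxIdeal F L ^ n := by
  let e : integralClosure 𝒪[F] L ≃+* integralClosure 𝒪[F] L :=
    MulSemiringAction.toRingEquiv Gal(L/K) _ σ
  let f : integralClosure 𝒪[F] L →+* integralClosure 𝒪[F] L := e
  have h1 : Ideal.map f (maxIdeal F L) = maxIdeal F L := by
    unfold maxIdeal
    rw [Ideal.map_jacobson_of_bijective (f := f) e.bijective, Ideal.map_bot]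
  have h2 : f x ∈ Ideal.map f (maxIdeal F L ^ n) := Ideal.mem_map_of_mem f hx
  rw [Ideal.map_pow, h1] at h2
  exact h2

theorem inertia_maxIdeal_pow_normal (K L : Type*) [Field K] [Field L] [Algebra F K] [Algebra F L]
    [Algebra K L] [IsScalarTower F K L] (n : ℕ) :
    ((maxIdeal F L ^ n).inertia Gal(L/K)).Normal where
  conj_mem σ hσ g x := by
    have h := smul_mem_maxIdeal_pow F K L n g (hσ (g⁻¹ • x))
    rwa [smul_sub, smul_inv_smul, smul_smul, smul_smul] at h

/-- The ramification group `Gal(L/K)_u` in the lower numbering, for real `u ≥ -1`: the elements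
acting trivially on `𝒪_L / 𝔪_L ^ (i + 1)`, where `i` is the smallest integer `≥ u`. -/
def lowerRamification (K L : Type*) [Field K] [Field L] [Algebra F K] [Algebra F L]
    [Algebra K L] [IsScalarTower F K L] (u : ℝ) : Subgroup Gal(L/K) :=
  (maxIdeal F L ^ (⌈u⌉ + 1).toNat).inertia Gal(L/K)

/-- The Hasse–Herbrand function `φ_{L/K}(u) = ∫_0^u dt / (G_0 : G_t)` on `[-1, ∞)`. -/
def herbrandPhi (K L : Type*) [Field K] [Field L] [Algebra F K] [Algebra F L]
    [Algebra K L] [IsScalarTower F K L] (u : ℝ) : ℝ :=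
  ∫ t in (0 : ℝ)..u,
    (((lowerRamification F K L t).relIndex (lowerRamification F K L 0) : ℕ) : ℝ)⁻¹

/-- The function `ψ_{L/K}` inverse to the bijection `φ_{L/K} : [-1, ∞) → [-1, ∞)`. -/
def herbrandPsi (K L : Type*) [Field K] [Field L] [Algebra F K] [Algebra F L]
    [Algebra K L] [IsScalarTower F K L] (v : ℝ) : ℝ :=
  Function.invFunOn (herbrandPhi F K L) (Set.Ici (-1)) v

/-- The ramification group `Gal(L/K)^v = Gal(L/K)_{ψ(v)}` in the upper numbering. -/
def upperRamification (K L : Type*) [Field K] [Field L] [Algebra F K] [Algebra F L]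
    [Algebra K L] [IsScalarTower F K L] (v : ℝ) : Subgroup Gal(L/K) :=
  lowerRamification F K L (herbrandPsi F K L v)

/-- The ramification group `Γ_K^v` of the absolute Galois group `Γ_K = Gal(Ω/K)`: the inverse limit
of the groups `Gal(L/K)^v` over the finite Galois extensions `L` of `K` in `Ω`. -/
def absRamification (K Ω : Type*) [Field K] [Field Ω] [Algebra F K] [Algebra F Ω]
    [Algebra K Ω] [IsScalarTower F K Ω] (v : ℝ) : Subgroup Gal(Ω/K) :=
  ⨅ L : FiniteGaloisIntermediateField K Ω,
    (upperRamification F K L v).comap (AlgEquiv.restrictNormalHom L)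

theorem absRamification_normal (K Ω : Type*) [Field K] [Field Ω] [Algebra F K] [Algebra F Ω]
    [Algebra K Ω] [IsScalarTower F K Ω] (v : ℝ) : (absRamification F K Ω v).Normal :=
  Subgroup.normal_iInf_normal fun L =>
    (inertia_maxIdeal_pow_normal F K L _).comap _

/-! ## The Weil group -/

/-- The Weil group `W_K` as an abstract subgroup of `Gal(Ω/K)`, for `K` finite over `F` and `Ω` a
separable closure: the `σ` that act on the residue field of `Ω` as an integral power of
`x ↦ x ^ q`, where `q` is the cardinality of the residue field of `F`. (If `K ≠ F`, then such a
`σ` fixes the residue field of `K`, so it acts as an integral power of the Frobenius of `K`.) -/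
def weilSubgroup (K Ω : Type*) [Field K] [Field Ω] [Algebra F K] [Algebra F Ω]
    [Algebra K Ω] [IsScalarTower F K Ω] : Subgroup Gal(Ω/K) where
  carrier := {σ | ∃ a b : ℕ, ∀ x : integralClosure 𝒪[F] Ω,
    (σ • x) ^ (Nat.card 𝓀[F] ^ a) - x ^ (Nat.card 𝓀[F] ^ b) ∈ maxIdeal F Ω}
  one_mem' := ⟨0, 0, fun x => by simp⟩
  mul_mem' := by
    rintro σ τ ⟨a, b, h⟩ ⟨c, d, h'⟩
    refine ⟨a + c, d + b, fun x => ?_⟩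
    have e1 := Ideal.mem_of_dvd (I := maxIdeal F Ω)
      (sub_dvd_pow_sub_pow ((σ • (τ • x)) ^ (Nat.card 𝓀[F] ^ a))
        ((τ • x) ^ (Nat.card 𝓀[F] ^ b)) (Nat.card 𝓀[F] ^ c)) (h (τ • x))
    have e2 := Ideal.mem_of_dvd (I := maxIdeal F Ω)
      (sub_dvd_pow_sub_pow ((τ • x) ^ (Nat.card 𝓀[F] ^ c))
        (x ^ (Nat.card 𝓀[F] ^ d)) (Nat.card 𝓀[F] ^ b)) (h' x)
    have e3 := Ideal.add_mem _ e1 e2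
    rw [← pow_mul, ← pow_mul, ← pow_mul, ← pow_mul, mul_comm (Nat.card 𝓀[F] ^ c),
      sub_add_sub_cancel, ← pow_add, ← pow_add, smul_smul] at e3
    exact e3
  inv_mem' := by
    rintro σ ⟨a, b, h⟩
    refine ⟨b, a, fun x => ?_⟩
    have := h (σ⁻¹ • x)
    rw [smul_inv_smul] at this
    rw [← neg_mem_iff, neg_sub]
    exact this

/-- The Weil group `W_K`, a type of its own because its topology is finer than the one
induced by `Gal(Ω/K)`. -/
def Weil (K Ω : Type*) [Field K] [Field Ω] [Algebra F K] [Algebra F Ω]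
    [Algebra K Ω] [IsScalarTower F K Ω] : Type _ := weilSubgroup F K Ω

end Ramification

section WeilGroup

variable (F : Type*) [Field F] [ValuativeRel F]
  (K Ω : Type*) [Field K] [Field Ω] [Algebra F K] [Algebra F Ω] [Algebra K Ω] [IsScalarTower F K Ω]

instance : Group (Weil F K Ω) := inferInstanceAs (Group (weilSubgroup F K Ω))

namespace Weil

/-- The inclusion of `W_K` in `Gal(Ω/K)`. -/
def toGal : Weil F K Ω →* Gal(Ω/K) := (weilSubgroup F K Ω).subtype

/-- The inertia subgroup `I_K` of `W_K`. -/
def inertia : Subgroup (Weil F K Ω) :=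
  ((maxIdeal F Ω).inertia Gal(Ω/K)).comap (toGal F K Ω)

instance : (inertia F K Ω).Normal := by
  have h := inertia_maxIdeal_pow_normal F K Ω 1
  rw [pow_one] at h
  exact h.comap _

/-- The topology of the Weil group: the coarsest one for which the inclusion in `Gal(Ω/K)` (with
its Krull topology) and the projection to `W_K / I_K` (with the discrete topology) are continuous.
Thus `I_K` is open in `W_K` and has its profinite topology. -/
instance : TopologicalSpace (Weil F K Ω) :=
  TopologicalSpace.induced (toGal F K Ω) inferInstance ⊓
    TopologicalSpace.induced (QuotientGroup.mk' (inertia F K Ω)) ⊥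

instance : IsTopologicalGroup (Weil F K Ω) := by
  have h : @IsTopologicalGroup (Weil F K Ω)
      (TopologicalSpace.induced (QuotientGroup.mk' (inertia F K Ω)) ⊥) _ := by
    let t : TopologicalSpace (Weil F K Ω ⧸ inertia F K Ω) := ⊥
    have : DiscreteTopology (Weil F K Ω ⧸ inertia F K Ω) := ⟨rfl⟩
    exact topologicalGroup_induced (QuotientGroup.mk' (inertia F K Ω))
  exact topologicalGroup_inf (topologicalGroup_induced (toGal F K Ω)) h

/-- The upper numbering filtration `W_K^r`, `r ≥ -1`. -/
def ramification (r : ℝ) : Subgroup (Weil F K Ω) :=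
  (absRamification F K Ω r).comap (toGal F K Ω)

/-- `W_K^{r+}`, the closure in `W_K` of the union of the decreasing family `W_K^s`, `s > r`. -/
def ramificationPlus (r : ℝ) : Subgroup (Weil F K Ω) :=
  (⨆ s : Set.Ioi r, ramification F K Ω s).topologicalClosure

instance (r : ℝ) : (ramificationPlus F K Ω r).Normal := by
  have : (⨆ s : Set.Ioi r, ramification F K Ω s).Normal := by
    have : ∀ s : Set.Ioi r, (ramification F K Ω s).Normal := fun s =>
      (absRamification_normal F K Ω s).comap _
    exact Subgroup.iSup_normal _
  exact Subgroup.is_normal_topologicalClosure _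

/-- The inclusion `W_K → W_F` of Weil groups of a finite extension `K/F`. -/
def toBase : Weil F K Ω →* Weil F F Ω :=
  ((AlgEquiv.restrictScalarsHom F).comp (toGal F K Ω)).codRestrict (weilSubgroup F F Ω)
    fun w => w.2

end Weil

end WeilGroup

/-! ## Non-abelian continuous cohomology -/

section Cohomology

variable {𝔤 𝔥 : Type*} [Group 𝔤] [TopologicalSpace 𝔤] [Group 𝔥] [TopologicalSpace 𝔥]

/-- Continuous `1`-cocycles of `𝔤` with values in the discrete group `A`. -/
structure Cocycle (𝔤 A : Type*) [Group 𝔤] [TopologicalSpace 𝔤] [Group A]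
    [MulDistribMulAction 𝔤 A] where
  toFun : 𝔤 → A
  map_mul : ∀ g h, toFun (g * h) = toFun g * g • toFun h
  continuous : IsLocallyConstant toFun

variable (𝔤) in
/-- Cohomologous cocycles: `β(g) = a⁻¹ α(g) ᵍa` for some `a`. -/
instance cocycleSetoid (A : Type*) [Group A] [MulDistribMulAction 𝔤 A] :
    Setoid (Cocycle 𝔤 A) where
  r α β := ∃ a : A, ∀ g, β.toFun g = a⁻¹ * α.toFun g * g • a
  iseqv :=
    { refl := fun α => ⟨1, fun g => by simp⟩
      symm := by
        rintro α β ⟨a, h⟩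
        exact ⟨a⁻¹, fun g => by rw [h, smul_inv']; group⟩
      trans := by
        rintro α β γ ⟨a, h⟩ ⟨b, h'⟩
        exact ⟨a * b, fun g => by rw [h', h, smul_mul']; group⟩ }

/-- The pointed set `H¹(𝔤, A)`. -/
def H1 (𝔤 A : Type*) [Group 𝔤] [TopologicalSpace 𝔤] [Group A] [MulDistribMulAction 𝔤 A] :
    Type _ := Quotient (cocycleSetoid 𝔤 A)

/-- The inflation of a cocycle of `𝔤 ⧸ N` with values in `A ^ N`. -/
def Cocycle.inflation {A : Type*} [Group A] [MulDistribMulAction 𝔤 A] (N : Subgroup 𝔤) [N.Normal]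
    (α : Cocycle (𝔤 ⧸ N) (FixedPoints.subgroup N A)) : Cocycle 𝔤 A where
  toFun g := (α.toFun (g : 𝔤 ⧸ N) : A)
  map_mul g h := congrArg Subtype.val (α.map_mul (g : 𝔤 ⧸ N) (h : 𝔤 ⧸ N))
  continuous := (α.continuous.comp_continuous QuotientGroup.continuous_mk).comp Subtype.val

/-- The canonical map `H¹(𝔤 ⧸ N, A ^ N) → H¹(𝔤, A)`. -/
def H1.inflation {A : Type*} [Group A] [MulDistribMulAction 𝔤 A] (N : Subgroup 𝔤) [N.Normal] :
    H1 (𝔤 ⧸ N) (FixedPoints.subgroup N A) → H1 𝔤 A :=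
  Quotient.map (Cocycle.inflation N) (by
    rintro α β ⟨a, h⟩
    exact ⟨a, fun g => congrArg Subtype.val (h (g : 𝔤 ⧸ N))⟩)

variable [IsTopologicalGroup 𝔤] (ι : 𝔥 →* 𝔤) (A : Type*) [Group A] [MulDistribMulAction 𝔥 A]

/-- The group of `𝔥`-equivariant maps `𝔤 → A` (where `𝔥` acts on `𝔤` by left translations through
`ι`) that are constant on the left cosets of some open subgroup of `𝔤`. -/
def inducedSubgroup : Subgroup (𝔤 → A) where
  carrier := {f | (∀ h x, f (ι h * x) = h • f x) ∧
    ∃ U : Subgroup 𝔤, IsOpen (U : Set 𝔤) ∧ ∀ x, ∀ u ∈ U, f (x * u) = f x}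
  one_mem' := ⟨fun h x => by simp, ⊤, isOpen_univ, fun x u _ => rfl⟩
  mul_mem' := by
    rintro f f' ⟨h, U, hU, h1⟩ ⟨h', U', hU', h1'⟩
    refine ⟨fun y x => by simp [h, h'], U ⊓ U', hU.inter hU', fun x u hu => ?_⟩
    simp [h1 x u hu.1, h1' x u hu.2]
  inv_mem' := by
    rintro f ⟨h, U, hU, h1⟩
    refine ⟨fun y x => by simp [h], U, hU, fun x u hu => ?_⟩
    simp [h1 x u hu]

/-- The induced group `Ind_𝔥^𝔤 A`. -/
def Induced : Type _ := inducedSubgroup ι A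

namespace Induced

instance : Group (Induced ι A) := inferInstanceAs (Group (inducedSubgroup ι A))

variable {ι A} in
/-- The value of an element of `Ind_𝔥^𝔤 A` at an element of `𝔤`. -/
def val (f : Induced ι A) (x : 𝔤) : A := Subtype.val (p := (· ∈ inducedSubgroup ι A)) f x

variable {ι A}

@[ext] theorem ext {f f' : Induced ι A} (h : ∀ x, f.val x = f'.val x) : f = f' :=
  Subtype.ext (funext h)

@[simp] theorem val_one (x : 𝔤) : (1 : Induced ι A).val x = 1 := rfl

@[simp] theorem val_mul (f f' : Induced ι A) (x : 𝔤) : (f * f').val x = f.val x * f'.val x := rfl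

@[simp] theorem val_inv (f : Induced ι A) (x : 𝔤) : (f⁻¹).val x = (f.val x)⁻¹ := rfl

theorem val_map_mul (f : Induced ι A) (h : 𝔥) (x : 𝔤) : f.val (ι h * x) = h • f.val x :=
  f.2.1 h x

variable (ι A) in
/-- `𝔤` acts on `Ind_𝔥^𝔤 A` by right translations, `(ᵍf)(x) = f(x g)`. -/
instance : MulDistribMulAction 𝔤 (Induced ι A) where
  smul g f := ⟨fun x => f.val (x * g), fun h x => by
      change f.val (ι h * x * g) = h • f.val (x * g)
      rw [mul_assoc, val_map_mul], by
    obtain ⟨U, hU, h⟩ := f.2.2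
    refine ⟨U.comap (MulAut.conj g⁻¹).toMonoidHom, ?_, fun x u hu => ?_⟩
    · exact hU.preimage (f := fun u => g⁻¹ * u * g⁻¹⁻¹)
        ((continuous_const.mul continuous_id).mul continuous_const)
    · have h2 := h (x * g) (g⁻¹ * u * g⁻¹⁻¹) hu
      have e : x * u * g = x * g * (g⁻¹ * u * g⁻¹⁻¹) := by group
      rw [← e] at h2
      exact h2⟩
  one_smul f := ext fun x => congrArg f.val (mul_one x)
  mul_smul g g' f := ext fun x => congrArg f.val (mul_assoc x g g').symm
  smul_mul _ _ _ := rfl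
  smul_one _ := rfl

@[simp] theorem val_smul (g : 𝔤) (f : Induced ι A) (x : 𝔤) : (g • f).val x = f.val (x * g) := rfl

theorem val_smul_one (f : Induced ι A) (h : 𝔥) : (ι h • f).val 1 = h • f.val 1 := by
  rw [val_smul, one_mul, ← val_map_mul, mul_one]

variable (ι A) in
/-- Evaluation at `1`, a homomorphism `Ind_𝔥^𝔤 A → A`. -/
def evalOne : Induced ι A →* A where
  toFun f := f.val 1
  map_one' := rfl
  map_mul' _ _ := rfl

end Induced

variable {ι A}

/-- The Shapiro map on cocycles: restrict to `𝔥` and evaluate at `1`. -/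
def Cocycle.shapiro (hι : Continuous ι) (α : Cocycle 𝔤 (Induced ι A)) : Cocycle 𝔥 A where
  toFun h := (α.toFun (ι h)).val 1
  map_mul g h := by
    rw [MonoidHom.map_mul, α.map_mul, Induced.val_mul, Induced.val_smul_one]
  continuous := (α.continuous.comp_continuous hι).comp fun f => f.val 1

/-- The Shapiro isomorphism `Sh : H¹(𝔤, Ind_𝔥^𝔤 A) → H¹(𝔥, A)`. -/
def H1.shapiro (hι : Continuous ι) : H1 𝔤 (Induced ι A) → H1 𝔥 A :=
  Quotient.map (Cocycle.shapiro hι) (by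
    rintro α β ⟨a, h⟩
    refine ⟨a.val 1, fun g => ?_⟩
    change (β.toFun (ι g)).val 1 = _
    rw [h, Induced.val_mul, Induced.val_mul, Induced.val_smul_one]
    rfl)

end Cohomology

/-! ## Complex linear algebraic groups -/

section AlgebraicGroup

/-- A ring of `ℂ`-valued functions on a group, called the regular functions. -/
class RegularFunctions (H : Type*) [Group H] where
  coord : Subalgebra ℂ (H → ℂ)

/-- The algebra of regular functions on `H`. -/
abbrev coord (H : Type*) [Group H] [RegularFunctions H] : Subalgebra ℂ (H → ℂ) :=
  RegularFunctions.coord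

/-- `H` with its regular functions is a complex linear (i.e. affine) algebraic group: the algebra of
regular functions is finitely generated, the points of `H` are the characters of that
algebra, and multiplication and inversion are morphisms. -/
class IsLinearAlgebraicGroup (H : Type*) [Group H] [RegularFunctions H] : Prop where
  fg : (coord H).FG
  points : ∀ χ : coord H →ₐ[ℂ] ℂ, ∃! h : H, ∀ f : coord H, χ f = f.1 h
  comul : ∀ f ∈ coord H, ∃ (n : ℕ) (a b : Fin n → coord H),
    ∀ x y, f (x * y) = ∑ i, (a i).1 x * (b i).1 y
  inv : ∀ f ∈ coord H, (fun x => f x⁻¹) ∈ coord H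

/-- Algebraic (finite-dimensional) representations of `H`. -/
def IsAlgebraicRep {H : Type*} [Group H] [RegularFunctions H] {n : ℕ}
    (ρ : H →* GL (Fin n) ℂ) : Prop :=
  ∀ i j, (fun h => (ρ h : Matrix (Fin n) (Fin n) ℂ) i j) ∈ coord H

/-- Semisimple elements: those acting semisimply in all algebraic representations. -/
def IsSemisimpleElt {H : Type*} [Group H] [RegularFunctions H] (h : H) : Prop :=
  ∀ (n : ℕ) (ρ : H →* GL (Fin n) ℂ), IsAlgebraicRep ρ →
    Module.End.IsSemisimple (Matrix.toLin' (ρ h : Matrix (Fin n) (Fin n) ℂ))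

/-- Unipotent elements: those acting unipotently in all algebraic representations. -/
def IsUnipotentElt {H : Type*} [Group H] [RegularFunctions H] (h : H) : Prop :=
  ∀ (n : ℕ) (ρ : H →* GL (Fin n) ℂ), IsAlgebraicRep ρ →
    IsNilpotent ((ρ h : Matrix (Fin n) (Fin n) ℂ) - 1)

/-- A complex connected reductive group: a connected linear algebraic group in which every
closed normal unipotent subgroup is trivial (such subgroups are automatically connected). -/
class IsConnectedReductive (H : Type*) [Group H] [RegularFunctions H] : Prop extends
    IsLinearAlgebraicGroup H where
  connected : ∀ f ∈ coord H, ∀ g ∈ coord H, f * g = 0 → f = 0 ∨ g = 0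
  reductive : ∀ U : Subgroup H, U.Normal →
    (∃ S : Set (H → ℂ), S ⊆ coord H ∧ ∀ h, h ∈ U ↔ ∀ f ∈ S, f h = 0) →
    (∀ u ∈ U, IsUnipotentElt u) → U = ⊥

/-- The regular functions on an induced group `Ind_𝔥^𝔤 H`, generated by `f ↦ a(f(x))` for `x` in `𝔤`
and `a` a regular function on `H`. (If `𝔥` has finite index in `𝔤`, then `Ind_𝔥^𝔤 H` is thus
a finite product of copies of `H` as an algebraic group.) -/
instance {𝔤 𝔥 : Type*} [Group 𝔤] [TopologicalSpace 𝔤] [Group 𝔥] [IsTopologicalGroup 𝔤]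
    (ι : 𝔥 →* 𝔤) (H : Type*) [Group H] [MulDistribMulAction 𝔥 H] [RegularFunctions H] :
    RegularFunctions (Induced ι H) where
  coord := Algebra.adjoin ℂ {F | ∃ a ∈ coord H, ∃ x : 𝔤, F = fun f => a (f.val x)}

end AlgebraicGroup

/-! ## L-groups and L-parameters -/

section LParameter

variable (F : Type*) [Field F] [ValuativeRel F]
  (K Ω : Type*) [Field K] [Field Ω] [Algebra F K] [Algebra F Ω] [Algebra K Ω] [IsScalarTower F K Ω]
  (H : Type*) [Group H] [RegularFunctions H] [MulDistribMulAction (Weil F K Ω) H]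

/-- `W_K` acts on `H` by automorphisms of algebraic groups, through a finite quotient of
`Gal(Ω/K)`. The action of `W_K` on the complex dual group of any connected reductive group over `K`
has this property (it moreover fixes a pinning, which is not required here). -/
class IsLAction : Prop where
  algebraic : ∀ (w : Weil F K Ω), ∀ f ∈ coord H, (fun h => f (w • h)) ∈ coord H
  finite : ∃ L : IntermediateField K Ω, FiniteDimensional K L ∧
    ∀ w : Weil F K Ω, (∀ x ∈ L, Weil.toGal F K Ω w x = x) → ∀ h : H, w • h = h

/-- The L-group `H ⋊ W_K`. -/
abbrev LGroup : Type _ :=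
  H ⋊[MulDistribMulAction.toMulAut (Weil F K Ω) H] Weil F K Ω

variable {F K Ω H} in
/-- Semisimple elements of `H ⋊ W_K`: those having a power `(h, w)` with `w` acting trivially on `H`
and `h` semisimple. Equivalently, the image in the algebraic group `H ⋊ Γ` is
semisimple, for any finite quotient `Γ` of `W_K` through which the action on `H` factors. -/
def LGroup.IsSemisimple (x : LGroup F K Ω H) : Prop :=
  ∃ n : ℕ, 0 < n ∧ (∀ h : H, (x ^ n).right • h = h) ∧ IsSemisimpleElt (x ^ n).left

/-- L-parameters: the homomorphisms `φ` from the Weil–Deligne group `W_K × SL₂(ℂ)` to the L-group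
`H ⋊ W_K`, over `W_K`, that are continuous on `W_K`, algebraic on `SL₂(ℂ)`, and map `W_K` to
semisimple elements. (As `W_K` is locally profinite, continuity for the complex topology of `H`
and for the discrete one amount to the same here.) -/
structure LParameter where
  toHom : Weil F K Ω × Matrix.SpecialLinearGroup (Fin 2) ℂ →* LGroup F K Ω H
  right_apply : ∀ p, (toHom p).right = p.1
  continuous : IsLocallyConstant fun w => (toHom (w, 1)).left
  algebraic : ∀ f ∈ coord H, ∃ P : MvPolynomial (Fin 2 × Fin 2) ℂ,
    ∀ x : Matrix.SpecialLinearGroup (Fin 2) ℂ,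
      f (toHom (1, x)).left = MvPolynomial.eval (fun ij => x.1 ij.1 ij.2) P
  semisimple : ∀ w, LGroup.IsSemisimple (toHom (w, 1))

/-- Equivalence of L-parameters: conjugation by an element of `H`. -/
instance lParameterSetoid : Setoid (LParameter F K Ω H) where
  r φ φ' := ∃ m : H, ∀ p, φ'.toHom p =
    SemidirectProduct.inl m * φ.toHom p * (SemidirectProduct.inl m)⁻¹
  iseqv :=
    { refl := fun φ => ⟨1, fun p => by simp⟩
      symm := by
        rintro φ φ' ⟨m, h⟩
        exact ⟨m⁻¹, fun p => by rw [h, map_inv]; group⟩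
      trans := by
        rintro φ φ' φ'' ⟨m, h⟩ ⟨m', h'⟩
        exact ⟨m' * m, fun p => by rw [h', h, map_mul]; group⟩ }

/-- The set `Φ` of `H`-conjugacy classes of L-parameters. -/
def LParameterClass : Type _ := Quotient (lParameterSetoid F K Ω H)

variable {F K Ω H}

/-- The restriction `α_φ` to `W_K` of the cocycle of an L-parameter `φ`. -/
def LParameter.cocycle (φ : LParameter F K Ω H) : Cocycle (Weil F K Ω) H where
  toFun w := (φ.toHom (w, 1)).left
  map_mul g h := by
    have e : ((g * h, 1) : Weil F K Ω × Matrix.SpecialLinearGroup (Fin 2) ℂ) =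
      (g, 1) * (h, 1) := by simp
    rw [e, map_mul, SemidirectProduct.mul_left, φ.right_apply]
    rfl
  continuous := φ.continuous

/-- The class `[α_φ]` in `H¹(W_K, H)`. -/
def LParameterClass.cohomologyClass : LParameterClass F K Ω H → H1 (Weil F K Ω) H :=
  Quotient.map LParameter.cocycle (by
    rintro φ φ' ⟨m, h⟩
    refine ⟨m⁻¹, fun w => ?_⟩
    change (φ'.toHom (w, 1)).left = _
    rw [h, ← map_inv, SemidirectProduct.mul_left, SemidirectProduct.mul_left,
      SemidirectProduct.mul_right, φ.right_apply]
    simp [LParameter.cocycle])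

/-- The depth of `φ`: the infimum of the `r ≥ 0` such that `[α_φ]` belongs to
`H¹(W_K / W_K^{r+}, H ^ (W_K^{r+}))`. -/
def LParameterClass.depth (φ : LParameterClass F K Ω H) : ℝ :=
  sInf {r : ℝ | 0 ≤ r ∧
    φ.cohomologyClass ∈ Set.range (H1.inflation (A := H) (Weil.ramificationPlus F K Ω r))}

end LParameter

/-! ## Weil restriction and the Shapiro map -/

section Shapiro

variable (F : Type*) [Field F] [ValuativeRel F]
  (E Ω : Type*) [Field E] [Field Ω] [Algebra F E] [Algebra F Ω] [Algebra E Ω] [IsScalarTower F E Ω]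

theorem continuous_restrictScalars [Algebra.IsIntegral F Ω] :
    Continuous (AlgEquiv.restrictScalarsHom F : Gal(Ω/E) →* Gal(Ω/F)) := by
  refine continuous_of_continuousAt_one _ ?_
  rw [ContinuousAt, map_one, Filter.tendsto_def]
  intro s hs
  obtain ⟨L, hL, hs⟩ := (krullTopology_mem_nhds_one_iff F Ω s).1 hs
  rw [krullTopology_mem_nhds_one_iff]
  let b := Module.finBasis F L
  have hi : ∀ x ∈ Set.range (fun i => (b i : Ω)), IsIntegral E x := fun x _ =>
    (Algebra.IsIntegral.isIntegral (R := F) x).tower_top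
  refine ⟨IntermediateField.adjoin E (Set.range fun i => (b i : Ω)),
    IntermediateField.finiteDimensional_adjoin hi, fun σ hσ => hs ?_⟩
  rw [SetLike.mem_coe, IntermediateField.mem_fixingSubgroup_iff] at hσ ⊢
  intro x hx
  have e : x = ∑ i, algebraMap F Ω (b.repr ⟨x, hx⟩ i) * (b i : Ω) := by
    have h := congrArg (Subtype.val : L → Ω) (b.sum_repr ⟨x, hx⟩)
    simp only [IntermediateField.coe_sum, Algebra.smul_def] at h
    exact h.symm
  have hb : ∀ i, σ (b i : Ω) = b i := fun i =>
    hσ _ (IntermediateField.subset_adjoin _ _ ⟨i, rfl⟩)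
  change σ x = x
  rw [e, map_sum]
  refine Finset.sum_congr rfl fun i _ => ?_
  rw [map_mul, hb, IsScalarTower.algebraMap_apply F E Ω, AlgEquiv.commutes]

theorem Weil.continuous_toGal : Continuous (Weil.toGal F E Ω) :=
  continuous_iff_le_induced.2 inf_le_left

theorem Weil.continuous_toBase [IsSepClosure F Ω] : Continuous (Weil.toBase F E Ω) := by
  have := IsSepClosure.separable (k := F) (K := Ω)
  refine (continuous_inf_rng (t₂ := TopologicalSpace.induced (Weil.toGal F F Ω) inferInstance)
    (t₃ := TopologicalSpace.induced (QuotientGroup.mk' (Weil.inertia F F Ω)) ⊥)).2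
    ⟨continuous_induced_rng.2 ?_, ?_⟩
  · exact (continuous_restrictScalars F E Ω).comp (Weil.continuous_toGal F E Ω)
  · have h : QuotientGroup.mk' (Weil.inertia F F Ω) ∘ Weil.toBase F E Ω =
        QuotientGroup.map (Weil.inertia F E Ω) (Weil.inertia F F Ω) (Weil.toBase F E Ω)
          (fun w hw => hw) ∘ QuotientGroup.mk' (Weil.inertia F E Ω) := rfl
    rw [continuous_iff_le_induced, induced_compose, h, ← induced_compose]
    exact inf_le_right.trans (induced_mono bot_le)

variable (G : Type*) [Group G] [MulDistribMulAction (Weil F E Ω) G]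

/-- The complex dual group `M^∨` of the Weil restriction `M` from `E` to `F` of a reductive group over
`E` with complex dual group `G`: the induced group `Ind_{W_E}^{W_F} G`, on which `W_F` acts by right
translations. -/
abbrev DualRes : Type _ := Induced (Weil.toBase F E Ω) G

variable [RegularFunctions G]

theorem DualRes.evalOne_surjective [FiniteDimensional F E] [IsLAction F E Ω G] :
    Function.Surjective (Induced.evalOne (Weil.toBase F E Ω) G) := by
  classical
  intro a
  obtain ⟨L, hL, hfin⟩ := IsLAction.finite (F := F) (K := E) (Ω := Ω) (H := G)
  have inj : Function.Injective (Weil.toBase F E Ω) := fun x y h =>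
    Subtype.ext (AlgEquiv.restrictScalars_injective F (congrArg Subtype.val h))
  let f : Weil F F Ω → G := fun x =>
    if h : ∃ w, Weil.toBase F E Ω w = x then h.choose • a else 1
  have f1 : ∀ w, f (Weil.toBase F E Ω w) = w • a := fun w => by
    have h : ∃ w', Weil.toBase F E Ω w' = Weil.toBase F E Ω w := ⟨w, rfl⟩
    simp only [f, dif_pos h]
    rw [inj h.choose_spec]
  have f2 : ∀ x, (¬ ∃ w, Weil.toBase F E Ω w = x) → f x = 1 := fun x h => dif_neg h
  have key : ∀ u : Weil F F Ω, (∀ x ∈ L.restrictScalars F, Weil.toGal F F Ω u x = x) →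
      ∃ w, Weil.toBase F E Ω w = u ∧ w • a = a := by
    intro u hu
    let σ : Gal(Ω/E) := AlgEquiv.ofRingEquiv (f := (Weil.toGal F F Ω u).toRingEquiv)
      fun x => hu _ (L.algebraMap_mem x)
    refine ⟨⟨σ, u.2⟩, rfl, hfin _ (fun x hx => hu x hx) a⟩
  refine ⟨⟨f, fun h x => ?_, ((L.restrictScalars F).fixingSubgroup).comap (Weil.toGal F F Ω), ?_,
    fun x u hu => ?_⟩, ?_⟩
  · by_cases hx : ∃ w, Weil.toBase F E Ω w = x
    · obtain ⟨w, rfl⟩ := hx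
      rw [← map_mul, f1, f1, mul_smul]
    · rw [f2 x hx, f2, smul_one]
      rintro ⟨w, hw⟩
      exact hx ⟨h⁻¹ * w, by rw [map_mul, hw, map_inv, inv_mul_cancel_left]⟩
  · have : FiniteDimensional F (L.restrictScalars F) := FiniteDimensional.trans F E L
    exact (L.restrictScalars F).fixingSubgroup_isOpen.preimage
      (Weil.continuous_toGal F F Ω)
  · obtain ⟨w, rfl, hw⟩ := key u
      ((IntermediateField.mem_fixingSubgroup_iff _ _).1 hu)
    by_cases hx : ∃ w, Weil.toBase F E Ω w = x
    · obtain ⟨w', rfl⟩ := hx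
      rw [← map_mul, f1, f1, mul_smul, hw]
    · rw [f2 x hx, f2]
      rintro ⟨w', hw'⟩
      exact hx ⟨w' * w⁻¹, by rw [map_mul, hw', map_inv, mul_inv_cancel_right]⟩
  · change f 1 = a
    rw [← map_one (Weil.toBase F E Ω), f1, one_smul]

variable {F E Ω G}

/-- The Shapiro map on L-parameters: `Sh(φ)(w, x) = (a(w, x)(1), w)` for `w` in `W_E`, where
`φ(w, x) = (a(w, x), w)`. -/
def LParameter.shapiro [IsSepClosure F Ω] [FiniteDimensional F E] [IsLAction F E Ω G]
    (φ : LParameter F F Ω (DualRes F E Ω G)) : LParameter F E Ω G where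
  toHom :=
    { toFun := fun p => ⟨(φ.toHom (Weil.toBase F E Ω p.1, p.2)).left.val 1, p.1⟩
      map_one' := by
        have e : (Weil.toBase F E Ω (1 : Weil F E Ω × Matrix.SpecialLinearGroup (Fin 2) ℂ).1,
          (1 : Weil F E Ω × Matrix.SpecialLinearGroup (Fin 2) ℂ).2) = 1 := by simp
        rw [e, map_one]
        rfl
      map_mul' := fun p p' => by
        have e : (Weil.toBase F E Ω (p * p').1, (p * p').2) =
          (Weil.toBase F E Ω p.1, p.2) * (Weil.toBase F E Ω p'.1, p'.2) := by simp
        rw [e, map_mul]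
        refine SemidirectProduct.ext ?_ rfl
        rw [SemidirectProduct.mul_left, SemidirectProduct.mul_left, Induced.val_mul,
          φ.right_apply]
        exact congrArg _ (Induced.val_smul_one _ _) }
  right_apply _ := rfl
  continuous := (φ.cocycle.shapiro (Weil.continuous_toBase F E Ω)).continuous
  algebraic f hf := by
    obtain ⟨P, hP⟩ := φ.algebraic (fun m => f (m.val 1)) (Algebra.subset_adjoin ⟨f, hf, 1, rfl⟩)
    refine ⟨P, fun x => ?_⟩
    rw [← hP]
    change f ((φ.toHom (Weil.toBase F E Ω 1, x)).left.val 1) = _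
    rw [map_one]
  semisimple w := by
    obtain ⟨n, hn, h1, h2⟩ := φ.semisimple (Weil.toBase F E Ω w)
    rw [← map_pow] at h1 h2
    refine ⟨n, hn, fun a => ?_, fun k ρ hρ => ?_⟩
    · obtain ⟨m, rfl⟩ := DualRes.evalOne_surjective F E Ω G a
      rw [← map_pow]
      have h := congrArg (fun m => Induced.val m 1) (h1 m)
      rw [φ.right_apply, Prod.pow_fst, ← map_pow] at h
      exact (Induced.val_smul_one m (w ^ n)).symm.trans h
    · rw [← map_pow]
      have h := h2 k (ρ.comp (Induced.evalOne (Weil.toBase F E Ω) G))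
        fun i j => Algebra.subset_adjoin ⟨_, hρ i j, 1, rfl⟩
      have e : (Weil.toBase F E Ω w, (1 : Matrix.SpecialLinearGroup (Fin 2) ℂ)) ^ n =
        (Weil.toBase F E Ω ((w, (1 : Matrix.SpecialLinearGroup (Fin 2) ℂ)) ^ n).1,
          ((w, (1 : Matrix.SpecialLinearGroup (Fin 2) ℂ)) ^ n).2) := by simp
      rw [e] at h
      exact h

/-- The Shapiro map `Sh` from classes of L-parameters of the Weil restriction over `F` to classes of
L-parameters over `E`. -/
def LParameterClass.shapiro [IsSepClosure F Ω] [FiniteDimensional F E] [IsLAction F E Ω G] :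
    LParameterClass F F Ω (DualRes F E Ω G) → LParameterClass F E Ω G :=
  Quotient.map LParameter.shapiro (by
    rintro φ φ' ⟨m, h⟩
    refine ⟨m.val 1, fun p => SemidirectProduct.ext ?_ ?_⟩
    · change (φ'.toHom (Weil.toBase F E Ω p.1, p.2)).left.val 1 = _
      rw [h, ← map_inv, ← map_inv, SemidirectProduct.mul_left, SemidirectProduct.mul_left,
        SemidirectProduct.mul_right, φ.right_apply, SemidirectProduct.mul_left,
        SemidirectProduct.mul_left, SemidirectProduct.mul_right]
      simp only [SemidirectProduct.left_inl, SemidirectProduct.right_inl, Induced.val_mul,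
        one_mul, map_one, MulAut.one_apply]
      exact congrArg _ (Induced.val_smul_one m⁻¹ p.1)
    · simp [LParameter.right_apply])

/-- `Sh` on L-parameters is the restriction of the Shapiro isomorphism in cohomology. -/
theorem LParameterClass.cohomologyClass_shapiro [IsSepClosure F Ω] [FiniteDimensional F E]
    [IsLAction F E Ω G] (φ : LParameterClass F F Ω (DualRes F E Ω G)) :
    φ.shapiro.cohomologyClass =
      H1.shapiro (Weil.continuous_toBase F E Ω) φ.cohomologyClass := by
  induction φ using Quotient.inductionOn
  rfl

end Shapiro

end

/-!
The class of a cocycle is inflated from `W_K / W_K^{r+}` if and only if its restriction to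
`W_K^{r+}` is trivial (`mem_range_inflation_iff`). So the depth is determined by the set of all `r`
for which the restriction is trivial, and the theorem follows from two facts.

The first is Shapiro's lemma on a normal subgroup `N` of `W_F` (`exists_trivialization_iff`): a
cocycle of `W_F` with values in the induced group is trivial on `N` if and only if its Shapiro
transform is trivial on `N ∩ W_E`. As `N` is normal, the intersections with the conjugates of `W_E`
need no separate treatment. A trivialisation on `N ∩ W_E` is extended to the double cosets of `W_E`
and `N`, and the result is smooth since the open normal subgroups form a basis of neighbourhoods of
`1` in the Weil group (`Weil.exists_normal_le`).

The second is `W_F^{r+} ∩ W_E = W_E^{ψ(r)+}`, where `ψ` belongs to `E / F`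
(`Weil.ramificationPlus_comap_toBase`). It is deduced from the Galois groups of finite extensions,
where it amounts to the transitivity of the Herbrand functions (`herbrandPsi_comp`) and to the
compatibility of the upper numbering with quotients (`upperRamification_map_le`). Both follow from
the formula that expresses the index function `i` of a quotient of a Galois group by that of the
group (`card_inertia_mul_lowerIndex`). For this formula the rings of integers have to be discrete
valuation rings that are generated by one element (`isDiscreteValuationRing_integralClosure`,
`exists_adjoin_eq_integralClosure`). The deduction of Herbrand's theorem from the formula is a
computation with finite sums of truncations `min(i(s), r)`, see `IsIndexedExtension`: the shifted
Herbrand function `φ(r - 1) + 1` is such a sum divided by its value at `1`.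

Finally `ψ` is an increasing bijection of `[0, ∞)` onto itself with `ψ(0) = 0`, so that it commutes
with the infimum in the definition of the depth (`StrictMonoOn.csInf_image_Ici`).
-/

noncomputable section

/-! ### Finite extensions of compact rings -/

section CompactLocal

/-- A domain that is finite and free over a compact Hausdorff ring is local. If `P ≠ Q` are maximal
ideals and `b ∈ P`, `b - 1 ∈ Q`, then the closure of the powers of `b` is a compact semigroup in
`P ∩ (1 + Q)`; it contains an idempotent, which in a domain can only be `0` or `1`. -/
theorem isLocalRing_of_finite_free_of_compactSpace (A B : Type*) [CommRing A] [TopologicalSpace A]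
    [IsTopologicalRing A] [CompactSpace A] [T2Space A] [IsNoetherianRing A] [CommRing B]
    [IsDomain B] [Algebra A B] [Module.Finite A B] [Module.Free A B] : IsLocalRing B := by
  let : TopologicalSpace B := moduleTopology A B
  have : IsModuleTopology A B := ⟨rfl⟩
  have : IsTopologicalRing B := IsModuleTopology.isTopologicalRing A B
  have : CompactSpace B := Module.Finite.compactSpace A B
  let e := (Module.Free.chooseBasis A B).equivFun
  have : T2Space B := T2Space.of_injective_continuous e.injective
    (IsModuleTopology.continuous_of_linearMap e.toLinearMap)
  have : IsNoetherianRing B := IsNoetherianRing.of_finite A B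
  refine IsLocalRing.of_unique_max_ideal ?_
  obtain ⟨P, hP⟩ := Ideal.exists_maximal B
  refine ⟨P, hP, fun Q hQ => ?_⟩
  by_contra hne
  obtain ⟨b, hb, c, hc, hbc⟩ := Submodule.mem_sup.1
    ((Ideal.eq_top_iff_one _).1 (hP.coprime_of_ne hQ (Ne.symm hne)))
  let S : Set B := {x | x ∈ P ∧ x - 1 ∈ Q}
  have hS : IsClosed S := by
    refine (IsNoetherianRing.isClosed_ideal P).inter ?_
    exact (IsNoetherianRing.isClosed_ideal Q).preimage (continuous_id.sub continuous_const)
  obtain ⟨x, hx, hxx⟩ := exists_idempotent_in_compact_subsemigroup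
    (fun r => by fun_prop) S ⟨b, hb, by
      have : b - 1 = -c := by rw [← hbc]; ring
      rw [this]; exact neg_mem hc⟩ hS.isCompact (by
      intro x hx y hy
      refine ⟨P.mul_mem_right _ hx.1, ?_⟩
      have : x * y - 1 = (x - 1) * y + (y - 1) := by ring
      rw [this]
      exact add_mem (Q.mul_mem_right _ hx.2) hy.2)
  rcases IsIdempotentElem.iff_eq_zero_or_one.1 (show IsIdempotentElem x from hxx) with h | h
  · apply hQ.ne_top
    rw [Ideal.eq_top_iff_one, ← neg_mem_iff]
    simpa [h] using hx.2
  · apply hP.ne_top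
    rw [Ideal.eq_top_iff_one]
    simpa [h] using hx.1

end CompactLocal

/-! ### Monogenic extensions of discrete valuation rings -/

section Monogenic

open IsLocalRing

variable (A B : Type*) [CommRing A] [IsLocalRing A] [CommRing B] [IsDomain B]
  [IsDiscreteValuationRing B] [Algebra A B] [Module.Finite A B] [Finite (ResidueField B)]

/-- A discrete valuation ring `B` with finite residue field `k` that is finite over a local ring `A`
is generated by one element over `A`: an `x` whose residue generates the group `kˣ` and for which
`x ^ q - x` is a uniformizer, where `q = #k`. -/
theorem exists_adjoin_singleton_eq_top (hA : (maximalIdeal A).map (algebraMap A B) ≠ ⊥) :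
    ∃ x : B, Algebra.adjoin A {x} = ⊤ := by
  classical
  obtain ⟨ϖ, hϖ⟩ := IsDiscreteValuationRing.exists_irreducible B
  let := Fintype.ofFinite (ResidueField B)
  set q := Fintype.card (ResidueField B) with hq
  have hq2 : 2 ≤ q := Fintype.one_lt_card
  have hϖm : ϖ ∈ maximalIdeal B := by
    rw [hϖ.maximalIdeal_eq]; exact Ideal.mem_span_singleton_self _
  obtain ⟨ζ, hζ⟩ := IsCyclic.exists_generator (α := (ResidueField B)ˣ)
  obtain ⟨x₀, hx₀⟩ := residue_surjective (R := B) (ζ : ResidueField B)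
  have hpow : ∀ x : B, x ^ q - x ∈ maximalIdeal B := fun x => by
    rw [← residue_eq_zero_iff, map_sub, map_pow, FiniteField.pow_card, sub_self]
  -- If `x₀ ^ q - x₀` is not a uniformizer, then `x₀ + ϖ` has this property, as `q ∈ 𝔪`.
  obtain ⟨x, hx, hx2⟩ : ∃ x : B, residue B x = ζ ∧ x ^ q - x ∉ maximalIdeal B ^ 2 := by
    by_cases h : x₀ ^ q - x₀ ∈ maximalIdeal B ^ 2
    · refine ⟨x₀ + ϖ, by rw [map_add, hx₀, (residue_eq_zero_iff _).2 hϖm, add_zero], fun h' => ?_⟩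
      obtain ⟨k, hk⟩ := Polynomial.powAddExpansion x₀ ϖ q
      have hqm : (q : B) ∈ maximalIdeal B := by
        rw [← residue_eq_zero_iff, map_natCast, hq, Nat.cast_card_eq_zero]
      have e : ϖ = (x₀ ^ q - x₀) - ((x₀ + ϖ) ^ q - (x₀ + ϖ)) + q * ϖ * x₀ ^ (q - 1) +
          ϖ ^ 2 * k := by rw [hk]; ring
      have h3 : ϖ ∈ maximalIdeal B ^ 2 := by
        rw [e]
        refine add_mem (add_mem (sub_mem h h') ?_) (Ideal.mul_mem_right _ _ ?_)
        · rw [pow_two (maximalIdeal B)]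
          exact Ideal.mul_mem_right _ _ (Ideal.mul_mem_mul hqm hϖm)
        · exact Ideal.pow_mem_pow hϖm 2
      rw [hϖ.maximalIdeal_eq, Ideal.span_singleton_pow, Ideal.mem_span_singleton,
        ← IsDiscreteValuationRing.addVal_le_iff_dvd, hϖ.addVal_pow,
        IsDiscreteValuationRing.addVal_uniformizer hϖ] at h3
      exact absurd h3 (by decide)
    · exact ⟨x₀, hx₀, h⟩
  set t := x ^ q - x with ht
  have htm : maximalIdeal B = Ideal.span {t} := by
    obtain ⟨c, hc⟩ : ϖ ∣ t := by
      rw [← Ideal.mem_span_singleton, ← hϖ.maximalIdeal_eq]; exact hpow x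
    have hcu : IsUnit c := by
      by_contra h
      apply hx2
      rw [hc, pow_two]
      exact Ideal.mul_mem_mul hϖm ((mem_maximalIdeal _).2 h)
    rw [hϖ.maximalIdeal_eq, Ideal.span_singleton_eq_span_singleton, hc]
    exact (associated_mul_unit_right ϖ c hcu)
  set S := Algebra.adjoin A {x} with hS
  have hxS : x ∈ S := Algebra.self_mem_adjoin_singleton A x
  have htS : t ∈ S := sub_mem (pow_mem hxS _) hxS
  have h1 : ∀ b : B, ∃ s ∈ S, b - s ∈ maximalIdeal B := fun b => by
    by_cases hb : residue B b = 0
    · exact ⟨0, zero_mem _, by rw [sub_zero]; exact (residue_eq_zero_iff _).1 hb⟩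
    · obtain ⟨n, hn⟩ := (mem_powers_iff_mem_zpowers (x := ζ)).2 (hζ (Units.mk0 _ hb))
      refine ⟨x ^ n, pow_mem hxS _, ?_⟩
      rw [← residue_eq_zero_iff, map_sub, map_pow, hx, ← Units.val_pow_eq_pow_val]
      simp only at hn
      rw [hn, Units.val_mk0, sub_self]
  -- Approximation by elements of `A[x]` modulo each power of `𝔪`; Nakayama's lemma does the rest.
  have h2 : ∀ n : ℕ, ∀ b : B, ∃ s ∈ S, b - s ∈ maximalIdeal B ^ n := fun n => by
    induction n with
    | zero => exact fun b => ⟨0, zero_mem _, by simp⟩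
    | succ n ih =>
      intro b
      obtain ⟨s, hs, hbs⟩ := h1 b
      rw [htm, Ideal.mem_span_singleton] at hbs
      obtain ⟨c, hc⟩ := hbs
      obtain ⟨s', hs', hcs⟩ := ih c
      refine ⟨s + t * s', add_mem hs (mul_mem htS hs'), ?_⟩
      have : b - (s + t * s') = t * (c - s') := by rw [mul_sub, ← hc]; ring
      rw [this, pow_succ', htm]
      rw [htm] at hcs
      exact Ideal.mul_mem_mul (Ideal.mem_span_singleton_self _) hcs
  obtain ⟨n, hn⟩ := IsDiscreteValuationRing.ideal_eq_span_pow_irreducible hA hϖ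
  refine ⟨x, ?_⟩
  have h3 : (⊤ : Submodule A B) ≤ Subalgebra.toSubmodule S := by
    refine Submodule.le_of_le_smul_of_le_jacobson_bot (I := maximalIdeal A)
      (Module.Finite.fg_top) (IsLocalRing.maximalIdeal_le_jacobson _) ?_
    intro b _
    obtain ⟨s, hs, hbs⟩ := h2 n b
    rw [← sub_add_cancel b s, add_comm]
    refine Submodule.add_mem_sup hs ?_
    rw [hϖ.maximalIdeal_eq, Ideal.span_singleton_pow, ← hn] at hbs
    rw [Ideal.smul_top_eq_map]
    exact hbs
  rw [eq_top_iff]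
  exact fun b _ => h3 (Submodule.mem_top (x := b))

end Monogenic

/-! ### Rings of integers of local fields -/

section LocalFieldExtension

open IsLocalRing

variable (F : Type*) [Field F] [ValuativeRel F] [TopologicalSpace F] [IsNonarchimedeanLocalField F]
  (L : Type*) [Field L] [Algebra F L] [FiniteDimensional F L] [Algebra.IsSeparable F L]

theorem t2Space_localField : T2Space F := by
  let := IsTopologicalAddGroup.rightUniformSpace F
  have := isUniformAddGroup_of_addCommGroup (G := F)
  infer_instance

theorem algebraMap_integralClosure_injective (L : Type*) [Field L] [Algebra F L] :
    Function.Injective (algebraMap 𝒪[F] (integralClosure 𝒪[F] L)) := fun _ _ h =>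
  Subtype.ext ((algebraMap F L).injective (congrArg Subtype.val h))

theorem finite_integralClosure : Module.Finite 𝒪[F] (integralClosure 𝒪[F] L) :=
  IsIntegralClosure.finite 𝒪[F] F L (integralClosure 𝒪[F] L)

theorem isLocalRing_integralClosure : IsLocalRing (integralClosure 𝒪[F] L) := by
  have := finite_integralClosure F L
  have := t2Space_localField F
  have : Module.IsTorsionFree 𝒪[F] (integralClosure 𝒪[F] L) :=
    Module.isTorsionFree_iff_algebraMap_injective.2 (algebraMap_integralClosure_injective F L)
  exact isLocalRing_of_finite_free_of_compactSpace 𝒪[F] _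

theorem map_maximalIdeal_integralClosure_ne_bot :
    (maximalIdeal 𝒪[F]).map (algebraMap 𝒪[F] (integralClosure 𝒪[F] L)) ≠ ⊥ := by
  rw [Ne, Ideal.map_eq_bot_iff_of_injective (algebraMap_integralClosure_injective F L)]
  exact IsDiscreteValuationRing.not_a_field _

instance isDiscreteValuationRing_integralClosure :
    IsDiscreteValuationRing (integralClosure 𝒪[F] L) := by
  have := isLocalRing_integralClosure F L
  have := integralClosure.isDedekindDomain 𝒪[F] F L
  have h : ¬ IsField (integralClosure 𝒪[F] L) := fun h =>
    IsDiscreteValuationRing.not_isField 𝒪[F]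
      (isField_of_isIntegral_of_isField (algebraMap_integralClosure_injective F L) h)
  exact ((IsDiscreteValuationRing.TFAE (integralClosure 𝒪[F] L) h).out 0 2).2
    (integralClosure.isDedekindDomain 𝒪[F] F L)

theorem finite_residueField_integralClosure :
    Finite (ResidueField (integralClosure 𝒪[F] L)) := by
  have := finite_integralClosure F L
  have : IsLocalHom (algebraMap 𝒪[F] (integralClosure 𝒪[F] L)) :=
    RingHom.IsIntegral.isLocalHom Algebra.IsIntegral.isIntegral
      (algebraMap_integralClosure_injective F L)
  exact ResidueField.finite_of_finite (R := 𝒪[F]) inferInstance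

theorem exists_adjoin_eq_integralClosure :
    ∃ x : integralClosure 𝒪[F] L, Algebra.adjoin 𝒪[F] {x} = ⊤ := by
  have := finite_integralClosure F L
  have := isDiscreteValuationRing_integralClosure F L
  have := finite_residueField_integralClosure F L
  exact exists_adjoin_singleton_eq_top 𝒪[F] _ (map_maximalIdeal_integralClosure_ne_bot F L)

theorem maxIdeal_eq_maximalIdeal :
    maxIdeal F L = maximalIdeal (integralClosure 𝒪[F] L) :=
  IsLocalRing.jacobson_eq_maximalIdeal ⊥ bot_ne_top

end LocalFieldExtension

/-! ### Rings of integers in a tower -/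

section Tower

variable (F : Type*) [Field F] [ValuativeRel F] [TopologicalSpace F] [IsNonarchimedeanLocalField F]
  (M L : Type*) [Field M] [Field L] [Algebra F M] [Algebra F L] [Algebra M L] [IsScalarTower F M L]
  [FiniteDimensional F L] [Algebra.IsSeparable F L] [FiniteDimensional F M]
  [Algebra.IsSeparable F M]

/-- The inclusion of the ring of integers of `M` in that of `L`, for an extension `L / M`. -/
def integralClosureMap : integralClosure 𝒪[F] M →ₐ[𝒪[F]] integralClosure 𝒪[F] L :=
  (IsScalarTower.toAlgHom 𝒪[F] M L).mapIntegralClosure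

/-- The ring of integers of `L` as an algebra over that of `M`, for an extension `L / M`. -/
abbrev integralClosureAlgebra : Algebra (integralClosure 𝒪[F] M) (integralClosure 𝒪[F] L) :=
  (integralClosureMap F M L).toRingHom.toAlgebra

attribute [local instance] integralClosureAlgebra

theorem isGaloisGroup_integralClosure [IsGalois M L] :
    IsGaloisGroup Gal(L/M) (integralClosure 𝒪[F] M) (integralClosure 𝒪[F] L) := by
  have := integralClosure.isFractionRing_of_finite_extension (A := 𝒪[F]) F L
  have := integralClosure.isFractionRing_of_finite_extension (A := 𝒪[F]) F M
  have : IsIntegrallyClosed (integralClosure 𝒪[F] M) :=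
    integralClosure.isIntegrallyClosedOfFiniteExtension F
  have : FiniteDimensional M L := FiniteDimensional.right F M L
  have : SMulDistribClass Gal(L/M) (integralClosure 𝒪[F] L) L := inferInstance
  have : IsScalarTower (integralClosure 𝒪[F] M) (integralClosure 𝒪[F] L) L :=
    .of_algebraMap_eq fun x => rfl
  have : IsScalarTower 𝒪[F] (integralClosure 𝒪[F] M) (integralClosure 𝒪[F] L) :=
    .of_algebraMap_eq' (integralClosureMap F M L).comp_algebraMap.symm
  have : Algebra.IsIntegral (integralClosure 𝒪[F] M) (integralClosure 𝒪[F] L) :=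
    Algebra.IsIntegral.tower_top 𝒪[F]
  exact IsGaloisGroup.of_isFractionRing _ _ _ M L

end Tower

/-! ### The index function of a group acting on a discrete valuation ring -/

section LowerIndex

open IsLocalRing
open IsDiscreteValuationRing hiding maximalIdeal

variable {G C : Type*} [Group G] [CommRing C] [IsDomain C] [IsDiscreteValuationRing C]
  [MulSemiringAction G C]

theorem mem_maximalIdeal_pow_iff (n : ℕ) (c : C) :
    c ∈ maximalIdeal C ^ n ↔ (n : ℕ∞) ≤ addVal C c := by
  obtain ⟨ϖ, hϖ⟩ := exists_irreducible C
  rw [hϖ.maximalIdeal_eq, Ideal.span_singleton_pow, Ideal.mem_span_singleton,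
    ← addVal_le_iff_dvd, hϖ.addVal_pow]

theorem addVal_prod {ι : Type*} (s : Finset ι) (f : ι → C) :
    addVal C (∏ i ∈ s, f i) = ∑ i ∈ s, addVal C (f i) := by
  classical
  induction s using Finset.induction_on with
  | empty => simp
  | insert a s ha ih => rw [Finset.prod_insert ha, Finset.sum_insert ha, addVal_mul, ih]

variable (C) in
/-- The function `i_G` of a group `G` acting on a discrete valuation ring `C`: the largest `n` such
that `s` acts trivially on `C / 𝔪 ^ n` (and `⊤` if `s` acts trivially on `C`). -/
def lowerIndex (s : G) : ℕ∞ := ⨅ c : C, addVal C (s • c - c)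

theorem le_lowerIndex_iff (n : ℕ) (s : G) :
    (n : ℕ∞) ≤ lowerIndex C s ↔ s ∈ (maximalIdeal C ^ n).inertia G := by
  rw [lowerIndex, le_iInf_iff]
  exact forall_congr' fun c => (mem_maximalIdeal_pow_iff n _).symm

theorem lowerIndex_le (s : G) (c : C) : lowerIndex C s ≤ addVal C (s • c - c) := iInf_le _ c

theorem lowerIndex_one : lowerIndex C (1 : G) = ⊤ := by simp [lowerIndex]

theorem min_le_lowerIndex_mul (s t : G) :
    min (lowerIndex C s) (lowerIndex C t) ≤ lowerIndex C (s * t) := le_iInf fun c => by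
  have e : (s * t) • c - c = (s • t • c - t • c) + (t • c - c) := by rw [mul_smul]; ring
  rw [e]
  exact (min_le_min (lowerIndex_le s _) (lowerIndex_le t c)).trans addVal_add

theorem lowerIndex_inv_le (s : G) : lowerIndex C s ≤ lowerIndex C s⁻¹ := le_iInf fun c => by
  have e : s⁻¹ • c - c = -1 * (s • s⁻¹ • c - s⁻¹ • c) := by rw [smul_inv_smul]; ring
  rw [e, addVal_mul]
  exact (lowerIndex_le s _).trans le_add_self

/-- If `s` has maximal index in its coset, then indices on this coset are determined by those
on the subgroup. -/
theorem lowerIndex_mul_eq_min (s t : G) (h : lowerIndex C (s * t) ≤ lowerIndex C s) :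
    lowerIndex C (s * t) = min (lowerIndex C s) (lowerIndex C t) := by
  refine le_antisymm (le_min h ?_) (min_le_lowerIndex_mul s t)
  have h1 := min_le_lowerIndex_mul (C := C) s⁻¹ (s * t)
  rw [inv_mul_cancel_left] at h1
  exact (le_min (h.trans (lowerIndex_inv_le s)) le_rfl).trans h1

variable {A : Type*} [CommRing A] [Algebra A C] [SMulCommClass G A C]

theorem smul_aeval (s : G) (x : C) (g : Polynomial A) :
    s • Polynomial.aeval x g = Polynomial.aeval (s • x) g :=
  (Polynomial.aeval_algHom_apply (MulSemiringAction.toAlgHom A C s) x g).symm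

theorem exists_aeval_eq {x : C} (hx : Algebra.adjoin A {x} = ⊤) (c : C) :
    ∃ g : Polynomial A, Polynomial.aeval x g = c := by
  have h : c ∈ Algebra.adjoin A {x} := hx ▸ Algebra.mem_top
  rwa [Algebra.adjoin_singleton_eq_range_aeval] at h

theorem smul_sub_dvd {x : C} (hx : Algebra.adjoin A {x} = ⊤) (s : G) (c : C) :
    s • x - x ∣ s • c - c := by
  obtain ⟨g, rfl⟩ := exists_aeval_eq hx c
  rw [smul_aeval, Polynomial.aeval_def, Polynomial.aeval_def, ← Polynomial.eval_map,
    ← Polynomial.eval_map]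
  exact Polynomial.sub_dvd_eval_sub _ _ _

theorem lowerIndex_eq_addVal {x : C} (hx : Algebra.adjoin A {x} = ⊤) (s : G) :
    lowerIndex C s = addVal C (s • x - x) :=
  le_antisymm (lowerIndex_le s x) (le_iInf fun c => addVal_le_iff_dvd.2 (smul_sub_dvd hx s c))

end LowerIndex

/-! ### The index function of a quotient group -/

section Quotient

open IsLocalRing Polynomial
open IsDiscreteValuationRing hiding maximalIdeal

variable {A B C : Type*} [CommRing A] [CommRing B] [IsDomain B] [IsDiscreteValuationRing B]
  [CommRing C] [IsDomain C] [IsDiscreteValuationRing C] [Algebra A B] [Algebra A C] [Algebra B C]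
  [FaithfulSMul B C]
  {G H Q : Type*} [Group G] [Group H] [Group Q] [MulSemiringAction G C] [MulSemiringAction H C]
  [MulSemiringAction Q B] [SMulCommClass G A C] [SMulCommClass H A C] [SMulCommClass Q A B]
  [IsGaloisGroup H B C] [Fintype H]

/-- The `B`-conjugates of a generator `x` of `C` over `A` are pairwise distinct, so their
characteristic polynomial divides each polynomial that vanishes on them. -/
theorem charpoly_dvd [FaithfulSMul H C] {x : C} (hx : Algebra.adjoin A {x} = ⊤) (P : C[X])
    (hP : ∀ t : H, P.eval (t • x) = 0) : MulSemiringAction.charpoly H x ∣ P := by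
  classical
  by_cases h0 : P = 0
  · rw [h0]; exact dvd_zero _
  have hinj : Function.Injective fun t : H => t • x := fun t t' h => by
    refine FaithfulSMul.eq_of_smul_eq_smul (α := C) fun c => ?_
    obtain ⟨g, rfl⟩ := exists_aeval_eq hx c
    rw [smul_aeval, smul_aeval]
    exact congrArg (fun z => aeval z g) h
  have h1 : MulSemiringAction.charpoly H x =
      ((Finset.univ.val.map fun t : H => t • x).map fun a => X - Polynomial.C a).prod := by
    rw [MulSemiringAction.charpoly_eq, Multiset.map_map]
    rfl
  rw [h1, Multiset.prod_X_sub_C_dvd_iff_le_roots h0, Multiset.le_iff_subset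
    (Finset.univ.nodup.map hinj)]
  intro a ha
  obtain ⟨t, -, rfl⟩ := Multiset.mem_map.1 ha
  exact (mem_roots h0).2 (hP t)

/-- The key step of Herbrand's theorem: if `x` and `y` generate `C` and `B`, then `σ y - y` and
`∏ (s t x - x)`, for `t` in the Galois group of `C / B`, generate the same ideal of `C`. Both are
compared with the value at `x` of `s f`, where `f` is the characteristic polynomial of `x`
over `B`. -/
theorem associated_smul_sub_prod {x : C} (hx : Algebra.adjoin A {x} = ⊤) {y : B}
    (hy : Algebra.adjoin A {y} = ⊤) (s : G) (σ : Q)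
    (hs : ∀ b : B, s • algebraMap B C b = algebraMap B C (σ • b)) :
    Associated (algebraMap B C (σ • y - y)) (∏ t : H, (s • t • x - x)) := by
  classical
  set f := MulSemiringAction.charpoly H x with hf
  let S : C →+* C := MulSemiringAction.toRingHom G C s
  have hfx : f.eval x = 0 := MulSemiringAction.eval_charpoly H x
  have hSf : (f.map S).eval x = ∏ t : H, (x - s • t • x) := by
    rw [hf, MulSemiringAction.charpoly_eq, Polynomial.map_prod, eval_prod]
    refine Finset.prod_congr rfl fun t _ => ?_
    simp [S]
  have hprod : Associated (∏ t : H, (s • t • x - x)) ((f.map S).eval x) := by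
    rw [hSf]
    refine Associated.prod _ _ _ fun t _ => ?_
    rw [← neg_sub]
    exact (Associated.refl _).neg_left
  refine Associated.trans (associated_of_dvd_dvd ?_ ?_) hprod.symm
  · have hinv := IsGaloisGroup.isInvariant (G := H) (A := B) (B := C)
    obtain ⟨f₀, hf₀⟩ := Algebra.IsInvariant.charpoly_mem_lifts B C H x
    let T : B →+* B := MulSemiringAction.toRingHom Q B σ
    have hf₀ : f₀.map (algebraMap B C) = f := hf₀
    have hST : S.comp (algebraMap B C) = (algebraMap B C).comp T := RingHom.ext hs
    have e : (f.map S).eval x = ((f₀.map T - f₀).map (algebraMap B C)).eval x := by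
      rw [Polynomial.map_sub, eval_sub, Polynomial.map_map, ← hST, ← Polynomial.map_map, hf₀, hfx,
        sub_zero]
    have hd : Polynomial.C (σ • y - y) ∣ f₀.map T - f₀ := by
      rw [C_dvd_iff_dvd_coeff]
      intro n
      rw [coeff_sub, coeff_map]
      exact smul_sub_dvd hy σ _
    obtain ⟨g, hg⟩ := hd
    rw [e, hg, Polynomial.map_mul, map_C, eval_mul, eval_C]
    exact dvd_mul_right _ _
  · obtain ⟨g, hg⟩ := exists_aeval_eq hx (algebraMap B C y)
    have hcomm := IsGaloisGroup.commutes (G := H) (A := B) (B := C)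
    have := IsGaloisGroup.faithful (G := H) B (B := C)
    obtain ⟨k, hk⟩ := charpoly_dvd (H := H) hx
      (g.map (algebraMap A C) - Polynomial.C (algebraMap B C y)) (fun t => by
        rw [eval_sub, eval_C, eval_map_algebraMap, ← smul_aeval, hg, smul_algebraMap, sub_self])
    have hk' := congrArg (fun p => (p.map S).eval x) hk
    have hSA : S.comp (algebraMap A C) = algebraMap A C :=
      RingHom.ext fun a => smul_algebraMap s a
    simp only [Polynomial.map_sub, Polynomial.map_mul, Polynomial.map_map, eval_sub, eval_mul,
      map_C, eval_C, hSA, eval_map_algebraMap, hg] at hk'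
    have e : S (algebraMap B C y) = algebraMap B C (σ • y) := hs y
    rw [e, ← neg_sub, ← map_sub] at hk'
    rw [← dvd_neg, hk']
    exact dvd_mul_right _ _

variable (B C H) in
/-- The valuation of `C` restricts to the multiple of that of `B` by the ramification index, which
is the order of the inertia group. -/
theorem addVal_algebraMap [Module.Finite B C] [Finite (ResidueField B)] (b : B) :
    addVal C (algebraMap B C b) = Nat.card ((maximalIdeal C).inertia H) * addVal B b := by
  have hinj := FaithfulSMul.algebraMap_injective B C
  have hloc : IsLocalHom (algebraMap B C) := inferInstance
  have : (maximalIdeal C).LiesOver (maximalIdeal B) := inferInstance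
  have : Module.IsTorsionFree B C := inferInstance
  obtain ⟨ϖ, hϖ⟩ := exists_irreducible B
  obtain ⟨e, he⟩ := ENat.ne_top_iff_exists.1 (mt addVal_eq_top_iff.1
    ((map_ne_zero_iff _ hinj).2 hϖ.ne_zero))
  have hle : ∀ n : ℕ, (maximalIdeal B).map (algebraMap B C) ≤ maximalIdeal C ^ n ↔ n ≤ e := by
    intro n
    rw [hϖ.maximalIdeal_eq, Ideal.map_span, Set.image_singleton, Ideal.span_singleton_le_iff_mem,
      mem_maximalIdeal_pow_iff, ← he, Nat.cast_le]
  have hcard : Nat.card ((maximalIdeal C).inertia H) = e := by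
    have : Finite (B ⧸ maximalIdeal B) := inferInstanceAs (Finite (ResidueField B))
    have : Finite (maximalIdeal B).ResidueField := Finite.of_surjective _
      (Ideal.bijective_algebraMap_quotient_residueField (maximalIdeal B)).surjective
    rw [Ideal.card_inertia_eq_ramificationIdxIn (maximalIdeal B),
      Ideal.ramificationIdxIn_eq_ramificationIdx _ (maximalIdeal C) H,
      ← Ideal.ramificationIdx'_eq_ramificationIdx (maximalIdeal B) _ (not_a_field B)]
    exact Ideal.ramificationIdx'_spec ((hle e).2 le_rfl) (mt (hle _).1 (by omega))
  rw [hcard]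
  by_cases hb : b = 0
  · have : e ≠ 0 := by
      rw [← hcard]
      exact Nat.card_pos.ne'
    rw [hb, map_zero, addVal_zero, addVal_zero, ENat.mul_top]
    exact_mod_cast this
  · obtain ⟨n, u, rfl⟩ := eq_unit_mul_pow_irreducible hb hϖ
    have hu : addVal C (algebraMap B C u) = 0 :=
      addVal_eq_zero_of_unit (Units.map (algebraMap B C).toMonoidHom u)
    rw [map_mul, map_pow, addVal_mul, addVal_pow, hu, ← he, zero_add, addVal_mul, addVal_pow,
      addVal_eq_zero_of_unit, addVal_uniformizer hϖ, zero_add]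
    simp [mul_comm]

/-- Serre's formula for the function `i` of a quotient group. -/
theorem card_inertia_mul_lowerIndex [Module.Finite B C] [Finite (ResidueField B)]
    (hC : ∃ x : C, Algebra.adjoin A {x} = ⊤) (hB : ∃ y : B, Algebra.adjoin A {y} = ⊤)
    (j : H →* G) (hj : ∀ (t : H) (c : C), j t • c = t • c) (s : G) (σ : Q)
    (hs : ∀ b : B, s • algebraMap B C b = algebraMap B C (σ • b)) :
    Nat.card ((maximalIdeal C).inertia H) * lowerIndex B σ = ∑ t : H, lowerIndex C (s * j t) := by
  obtain ⟨x, hx⟩ := hC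
  obtain ⟨y, hy⟩ := hB
  rw [lowerIndex_eq_addVal hy, ← addVal_algebraMap B C H,
    (addVal_eq_iff_associated _ _).2 (associated_smul_sub_prod (H := H) hx hy s σ hs), addVal_prod]
  refine Finset.sum_congr rfl fun t _ => ?_
  rw [lowerIndex_eq_addVal hx, mul_smul, hj]

end Quotient

/-! ### Truncation of extended natural numbers -/

section Truncation

/-- The minimum of `a ∈ ℕ ∪ {∞}` and a real number `r`, as a real number. -/
def truncMin (a : ℕ∞) (r : ℝ) : ℝ := ENat.recTopCoe r (fun n : ℕ => min (n : ℝ) r) a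

@[simp] theorem truncMin_top (r : ℝ) : truncMin ⊤ r = r := rfl

@[simp] theorem truncMin_coe (n : ℕ) (r : ℝ) : truncMin n r = min (n : ℝ) r := rfl

theorem truncMin_le (a : ℕ∞) (r : ℝ) : truncMin a r ≤ r := by
  cases a <;> simp

theorem monotone_truncMin (a : ℕ∞) : Monotone (truncMin a) := fun r r' h => by
  cases a
  · simpa
  · exact min_le_min le_rfl h

theorem continuous_truncMin (a : ℕ∞) : Continuous (truncMin a) := by
  cases a
  · exact continuous_id
  · exact continuous_const.min continuous_id

theorem truncMin_min (a b : ℕ∞) (r : ℝ) : truncMin (min a b) r = truncMin b (truncMin a r) := by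
  cases a with
  | top => simp
  | coe m =>
    cases b with
    | top => simp
    | coe n =>
      rw [← (Nat.mono_cast (α := ℕ∞)).map_min, truncMin_coe, truncMin_coe, truncMin_coe,
        Nat.cast_min, ← min_assoc, min_comm (n : ℝ)]

theorem truncMin_zero (a : ℕ∞) : truncMin a 0 = 0 := by
  cases a <;> simp

theorem truncMin_nonneg (a : ℕ∞) {r : ℝ} (hr : 0 ≤ r) : 0 ≤ truncMin a r :=
  (truncMin_zero a).symm.le.trans (monotone_truncMin a hr)

theorem truncMin_one (a : ℕ∞) : truncMin a 1 = if 1 ≤ a then 1 else 0 := by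
  cases a with
  | top => simp
  | coe n =>
    rcases n with _ | n
    · exact (truncMin_coe 0 1).trans (by simp)
    · have : (1 : ℕ∞) ≤ ((n + 1 : ℕ) : ℕ∞) := by exact_mod_cast Nat.le_add_left 1 n
      rw [if_pos this, truncMin_coe, min_eq_right]
      exact_mod_cast Nat.le_add_left 1 n

theorem le_truncMin_iff (a : ℕ∞) (r : ℝ) : r ≤ truncMin a r ↔ ((⌈r⌉.toNat : ℕ) : ℕ∞) ≤ a := by
  cases a with
  | top => simp
  | coe n =>
    rw [truncMin_coe, le_min_iff, and_iff_left le_rfl, Nat.cast_le, Int.toNat_le, Int.ceil_le]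
    simp

/-- Here `t + 1 ≤ truncMin a (t + 1)` says that `t + 1 ≤ a`, so that the integrand is the indicator
function of the lower numbering condition for an element of index `a`. -/
theorem integral_truncMin {a : ℕ∞} (ha : 1 ≤ a) (u : ℝ) :
    ∫ t in (0 : ℝ)..u, (if t + 1 ≤ truncMin a (t + 1) then (1 : ℝ) else 0) =
      truncMin a (u + 1) - 1 := by
  cases a with
  | top => simp
  | coe n =>
    have hn : (1 : ℝ) ≤ n := by exact_mod_cast ha
    have hint : ∀ x y : ℝ, IntervalIntegrable
        (fun t : ℝ => if t + 1 ≤ truncMin n (t + 1) then (1 : ℝ) else 0) MeasureTheory.volume x y :=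
      fun x y => by
      refine Antitone.intervalIntegrable fun t t' h => ?_
      simp only [truncMin_coe, le_min_iff, le_refl, and_true]
      split_ifs <;> linarith
    have h1 : ∀ v : ℝ, v + 1 ≤ n →
        ∫ t in (0 : ℝ)..v, (if t + 1 ≤ truncMin n (t + 1) then (1 : ℝ) else 0) = v := fun v hv => by
      rw [intervalIntegral.integral_congr (g := fun _ => (1 : ℝ))]
      · simp
      · intro t ht
        have : t ≤ max 0 v := ht.2
        have : t + 1 ≤ n := by rcases le_total 0 v with h | h <;> simp [h] at this <;> linarith
        simp [this]
    rcases le_total (u + 1) n with h | h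
    · rw [h1 u h, truncMin_coe, min_eq_right h, add_sub_cancel_right]
    · rw [← intervalIntegral.integral_add_adjacent_intervals (hint 0 (n - 1)) (hint (n - 1) u),
        h1 _ (by linarith), truncMin_coe, min_eq_left h]
      rw [add_eq_left]
      refine intervalIntegral.integral_zero_ae (Filter.Eventually.of_forall fun t ht => ?_)
      rw [Set.uIoc_of_le (by linarith)] at ht
      have : ¬ t + 1 ≤ n := by have := ht.1; linarith
      simp [this]

end Truncation

/-! ### Herbrand functions of index functions -/

section HerbrandSum

variable {G : Type*} [Fintype G]

/-- The sum `∑ min(i(s), r)`. -/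
def truncSum (i : G → ℕ∞) (r : ℝ) : ℝ := ∑ s, truncMin (i s) r

/-- The Herbrand function of a finite group with index function `i`, normalised by a shift of both
source and target by `1`: it is `r ↦ φ(r - 1) + 1` for `r ≥ 0`. -/
def shiftedPhi (i : G → ℕ∞) (r : ℝ) : ℝ := truncSum i r / truncSum i 1

theorem truncSum_one (i : G → ℕ∞) : truncSum i 1 = Nat.card {s | 1 ≤ i s} := by
  classical
  simp only [truncSum, truncMin_one]
  rw [Finset.sum_boole, Nat.card_eq_fintype_card, Fintype.card_subtype]
  rfl

theorem le_truncSum {i : G → ℕ∞} {e : G} (he : i e = ⊤) {r : ℝ} (hr : 0 ≤ r) :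
    r ≤ truncSum i r := by
  have := Finset.single_le_sum (f := fun s => truncMin (i s) r)
    (fun s _ => truncMin_nonneg (i s) hr) (Finset.mem_univ e)
  simp only [he, truncMin_top] at this
  exact this

theorem truncSum_one_pos {i : G → ℕ∞} {e : G} (he : i e = ⊤) : 0 < truncSum i 1 :=
  zero_lt_one.trans_le (le_truncSum he zero_le_one)

theorem strictMono_shiftedPhi {i : G → ℕ∞} {e : G} (he : i e = ⊤) : StrictMono (shiftedPhi i) :=
  fun r r' h => by
    refine div_lt_div_of_pos_right ?_ (truncSum_one_pos he)
    exact Finset.sum_lt_sum (fun s _ => monotone_truncMin (i s) h.le)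
      ⟨e, Finset.mem_univ e, by simpa [he]⟩

theorem continuous_shiftedPhi (i : G → ℕ∞) : Continuous (shiftedPhi i) :=
  (continuous_finsetSum _ fun s _ => continuous_truncMin (i s)).div_const _

theorem shiftedPhi_zero (i : G → ℕ∞) : shiftedPhi i 0 = 0 := by
  simp [shiftedPhi, truncSum, truncMin_zero]

theorem shiftedPhi_one {i : G → ℕ∞} {e : G} (he : i e = ⊤) : shiftedPhi i 1 = 1 :=
  div_self (truncSum_one_pos he).ne'

theorem bijOn_shiftedPhi {i : G → ℕ∞} {e : G} (he : i e = ⊤) :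
    Set.BijOn (shiftedPhi i) (Set.Ici 0) (Set.Ici 0) := by
  have hm := strictMono_shiftedPhi he
  refine ⟨fun r hr => ?_, hm.injective.injOn, fun v hv => ?_⟩
  · rw [Set.mem_Ici, ← shiftedPhi_zero i]
    exact hm.monotone hr
  · have hv : (0 : ℝ) ≤ v := hv
    have h0 := (truncSum_one_pos he)
    have h1 : v ≤ shiftedPhi i (v * truncSum i 1) := by
      rw [shiftedPhi, le_div_iff₀ h0]
      exact le_truncSum he (mul_nonneg hv h0.le)
    obtain ⟨r, hr, h⟩ := intermediate_value_Icc (mul_nonneg hv h0.le)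
      (continuous_shiftedPhi i).continuousOn ⟨(shiftedPhi_zero i).le.trans hv, h1⟩
    exact ⟨r, hr.1, h⟩

end HerbrandSum

/-! ### Herbrand's theorem for index functions -/

section HerbrandQuotient

variable {G H Q : Type*} [Group G] [Group H] [Group Q] [Fintype G] [Fintype H] [Fintype Q]
  (π : G →* Q) (j : H →* G) (iG : G → ℕ∞) (iH : H → ℕ∞) (iQ : Q → ℕ∞)

/-- The relations between the index functions `i` of a finite Galois group `G`, of a normal subgroup
`H` and of the quotient `Q`, from which Herbrand's theorem follows formally. -/
structure IsIndexedExtension : Prop where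
  surjective : Function.Surjective π
  injective : Function.Injective j
  range_eq : j.range = π.ker
  one : iG 1 = ⊤
  comp : ∀ t, iG (j t) = iH t
  mul_eq : ∀ s t, iG (s * t) ≤ iG s → iG (s * t) = min (iG s) (iG t)
  sum_eq : ∀ s, Nat.card {t | 1 ≤ iH t} * iQ (π s) = ∑ t, iG (s * j t)

variable {π j iG iH iQ}

namespace IsIndexedExtension

variable (h : IsIndexedExtension π j iG iH iQ)
include h

theorem iH_one : iH 1 = ⊤ := by rw [← h.comp, map_one, h.one]

/-- An element `s` of maximal index in its fibre over `Q`. -/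
theorem exists_max (σ : Q) : ∃ s, π s = σ ∧ ∀ t, iG (s * j t) = min (iG s) (iH t) := by
  classical
  obtain ⟨s₀, hs₀⟩ := h.surjective σ
  obtain ⟨s, hs, hmax⟩ := Finset.exists_max_image (Finset.univ.filter fun s => π s = σ) iG
    ⟨s₀, by simp [hs₀]⟩
  have hs : π s = σ := by simpa using hs
  refine ⟨s, hs, fun t => ?_⟩
  rw [← h.comp]
  refine h.mul_eq _ _ (hmax _ ?_)
  have : π (j t) = 1 := by
    rw [← MonoidHom.mem_ker, ← h.range_eq]; exact ⟨t, rfl⟩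
  simp [hs, this]

/-- The index of `σ` in `Q` is the value of the Herbrand function of `H` at the maximal index of a
lift of `σ` to `G`; the statement is truncated at `r` to include the index `⊤`. -/
theorem truncMin_shiftedPhi {s : G} (hs : ∀ t, iG (s * j t) = min (iG s) (iH t)) (r : ℝ) :
    truncMin (iQ (π s)) (shiftedPhi iH r) = shiftedPhi iH (truncMin (iG s) r) := by
  have hone := h.iH_one
  have hpos := truncSum_one_pos hone
  have hsum := h.sum_eq s
  simp only [hs] at hsum
  have hcard : ((Nat.card {t | 1 ≤ iH t} : ℕ) : ℝ) = truncSum iH 1 := (truncSum_one iH).symm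
  generalize Nat.card {t | 1 ≤ iH t} = c at hsum hcard
  have hc : c ≠ 0 := by rintro rfl; simp at hcard; linarith
  cases hm : iG s with
  | top =>
    have : iQ (π s) = ⊤ := by
      have h1 : (⊤ : ℕ∞) ≤ ∑ t, min (iG s) (iH t) := by
        refine le_trans ?_ (Finset.single_le_sum (f := fun t => min (iG s) (iH t))
          (fun _ _ => zero_le) (Finset.mem_univ (1 : H)))
        simp [hm, hone]
      rw [← hsum, top_le_iff] at h1
      cases hq : iQ (π s) with
      | top => rfl
      | coe q =>
        rw [hq, ← Nat.cast_mul] at h1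
        exact absurd h1 (ENat.natCast_ne_top _)
    rw [this, truncMin_top, truncMin_top]
  | coe m =>
    rw [hm] at hsum
    have hfin : ∀ a : ℕ∞, ∃ k : ℕ, min (m : ℕ∞) a = k ∧ truncMin a m = k := fun a => by
      cases a with
      | top => exact ⟨m, by simp, by simp⟩
      | coe n =>
        exact ⟨min m n, (Nat.mono_cast (α := ℕ∞)).map_min.symm, by
          rw [truncMin_coe, min_comm]; simp⟩
    choose k hk1 hk2 using fun t => hfin (iH t)
    rw [Finset.sum_congr rfl fun t _ => hk1 t] at hsum
    have h2 : truncSum iH m = ∑ t, (k t : ℝ) := Finset.sum_congr rfl fun t _ => hk2 t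
    rw [← Nat.cast_sum] at hsum
    cases hq : iQ (π s) with
    | top =>
      rw [hq, ENat.mul_top (by exact_mod_cast hc)] at hsum
      exact absurd hsum.symm (ENat.natCast_ne_top _)
    | coe q =>
      rw [hq] at hsum
      have h3 : (c : ℝ) * q = ∑ t, (k t : ℝ) := by exact_mod_cast hsum
      have h4 : (q : ℝ) = shiftedPhi iH m := by
        rw [shiftedPhi, h2, ← h3, ← hcard, mul_div_cancel_left₀]
        exact_mod_cast hc
      rw [truncMin_coe, truncMin_coe, h4, (strictMono_shiftedPhi hone).monotone.map_min]

/-- Herbrand's theorem: the image of the lower numbering filtration of `G` in the quotient `Q`. -/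
theorem shiftedPhi_le_truncMin_iff (σ : Q) (r : ℝ) :
    shiftedPhi iH r ≤ truncMin (iQ σ) (shiftedPhi iH r) ↔
      ∃ s, π s = σ ∧ r ≤ truncMin (iG s) r := by
  constructor
  · intro hσ
    obtain ⟨s, rfl, hs⟩ := h.exists_max σ
    rw [h.truncMin_shiftedPhi hs, (strictMono_shiftedPhi h.iH_one).le_iff_le] at hσ
    exact ⟨s, rfl, hσ⟩
  · rintro ⟨s', rfl, hs'⟩
    obtain ⟨s, hss, hs⟩ := h.exists_max (π s')
    obtain ⟨t, ht⟩ : s⁻¹ * s' ∈ j.range := by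
      rw [h.range_eq, MonoidHom.mem_ker, map_mul, map_inv, hss, inv_mul_cancel]
    have e : s' = s * j t := by rw [ht, mul_inv_cancel_left]
    rw [e, hs, truncMin_min] at hs'
    rw [← hss, h.truncMin_shiftedPhi hs, (strictMono_shiftedPhi h.iH_one).le_iff_le]
    exact hs'.trans (truncMin_le _ _)

/-- Summation over `G` in terms of the products `s t`, where `s` runs through lifts of maximal index
of the elements of `Q` and `t` through `H`. -/
theorem sum_truncMin (r : ℝ) :
    truncSum iQ (shiftedPhi iH r) = truncSum iG r / truncSum iH 1 := by
  choose s hsπ hs using h.exists_max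
  have hbij : Function.Bijective fun p : Q × H => s p.1 * j p.2 := by
    constructor
    · rintro ⟨σ, t⟩ ⟨σ', t'⟩ hp
      have hk : ∀ t, π (j t) = 1 := fun t => by
        rw [← MonoidHom.mem_ker, ← h.range_eq]; exact ⟨t, rfl⟩
      have h1 := congrArg π hp
      simp only [map_mul, hsπ, hk, mul_one] at h1
      subst h1
      simp only [mul_right_inj] at hp
      rw [h.injective hp]
    · intro g
      obtain ⟨t, ht⟩ : (s (π g))⁻¹ * g ∈ j.range := by
        rw [h.range_eq, MonoidHom.mem_ker, map_mul, map_inv, hsπ, inv_mul_cancel]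
      exact ⟨(π g, t), by simp [ht]⟩
  have h1 : truncSum iG r = ∑ p : Q × H, truncMin (iG (s p.1 * j p.2)) r :=
    (Function.Bijective.sum_comp hbij fun g => truncMin (iG g) r).symm
  rw [h1, Fintype.sum_prod_type, Finset.sum_div]
  refine Finset.sum_congr rfl fun σ _ => ?_
  have h2 := h.truncMin_shiftedPhi (hs σ) r
  rw [hsπ] at h2
  rw [h2, shiftedPhi, truncSum]
  congr 1
  refine Finset.sum_congr rfl fun t _ => ?_
  rw [hs, truncMin_min]

/-- Transitivity of the Herbrand functions. -/
theorem shiftedPhi_comp (r : ℝ) : shiftedPhi iQ (shiftedPhi iH r) = shiftedPhi iG r := by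
  have h0 := (truncSum_one_pos h.iH_one).ne'
  have h1 := h.sum_truncMin 1
  rw [shiftedPhi_one h.iH_one] at h1
  rw [shiftedPhi, h.sum_truncMin, h1, shiftedPhi, div_div_div_cancel_right₀ h0]

end IsIndexedExtension

end HerbrandQuotient

/-! ### Lower numbering and the Herbrand function -/

section GaloisIndex

open IsLocalRing

variable (F : Type*) [Field F] [ValuativeRel F] [TopologicalSpace F] [IsNonarchimedeanLocalField F]
  (K L : Type*) [Field K] [Field L] [Algebra F K] [Algebra F L] [Algebra K L] [IsScalarTower F K L]
  [FiniteDimensional F L] [Algebra.IsSeparable F L] [FiniteDimensional K L]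

/-- The function `i` of the Galois group of `L / K`, for `L` finite separable over the local
field `F`. -/
def galoisIndex : Gal(L/K) → ℕ∞ := lowerIndex (integralClosure 𝒪[F] L)

theorem galoisIndex_one : galoisIndex F K L 1 = ⊤ := lowerIndex_one

/-- The condition means that `u + 1 ≤ i(s)`; truncation states it in the real numbers. -/
theorem mem_lowerRamification_iff (u : ℝ) (s : Gal(L/K)) :
    s ∈ lowerRamification F K L u ↔ u + 1 ≤ truncMin (galoisIndex F K L s) (u + 1) := by
  rw [le_truncMin_iff, Int.ceil_add_one, lowerRamification, maxIdeal_eq_maximalIdeal]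
  exact (le_lowerIndex_iff _ s).symm

theorem mem_lowerRamification_zero_iff (s : Gal(L/K)) :
    s ∈ lowerRamification F K L 0 ↔ 1 ≤ galoisIndex F K L s := by
  rw [mem_lowerRamification_iff, le_truncMin_iff]
  simp

theorem lowerRamification_antitone : Antitone (lowerRamification F K L) := fun u v h s hs => by
  rw [mem_lowerRamification_iff, le_truncMin_iff] at hs ⊢
  refine le_trans ?_ hs
  exact_mod_cast Int.toNat_le_toNat (Int.ceil_mono (by linarith))

/-- The integral that defines the Herbrand function is `(∑ min(i(s), u + 1)) / #Γ_0 - 1`. -/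
theorem herbrandPhi_add_one {u : ℝ} (hu : -1 ≤ u) :
    herbrandPhi F K L u + 1 = shiftedPhi (galoisIndex F K L) (u + 1) := by
  classical
  set i := galoisIndex F K L with hi
  have h1 := truncSum_one i
  have hpos : 0 < truncSum i 1 := truncSum_one_pos (galoisIndex_one F K L)
  have hG0 : Nat.card (lowerRamification F K L 0) = Nat.card {s | 1 ≤ i s} :=
    Nat.card_congr (Equiv.subtypeEquivRight fun s => mem_lowerRamification_zero_iff F K L s)
  have hint : ∀ t : ℝ,
      (((lowerRamification F K L t).relIndex (lowerRamification F K L 0) : ℕ) : ℝ)⁻¹ =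
        (∑ s with 1 ≤ i s, if t + 1 ≤ truncMin (i s) (t + 1) then (1 : ℝ) else 0) /
          truncSum i 1 := fun t => by
    have e1 : Nat.card ↥(lowerRamification F K L t ⊓ lowerRamification F K L 0) *
        (lowerRamification F K L t).relIndex (lowerRamification F K L 0) =
        Nat.card (lowerRamification F K L 0) := by
      rw [← Subgroup.inf_relIndex_right, ← Subgroup.relIndex_bot_left, ← Subgroup.relIndex_bot_left,
        Subgroup.relIndex_mul_relIndex _ _ _ bot_le inf_le_right]
    have e2 : (Nat.card ↥(lowerRamification F K L t ⊓ lowerRamification F K L 0) : ℝ) =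
        ∑ s with 1 ≤ i s, if t + 1 ≤ truncMin (i s) (t + 1) then (1 : ℝ) else 0 := by
      rw [Finset.sum_boole, Finset.filter_filter, Nat.card_eq_fintype_card,
        Fintype.card_of_subtype]
      intro s
      rw [Finset.mem_filter, Subgroup.mem_inf, mem_lowerRamification_iff,
        mem_lowerRamification_zero_iff]
      simp [and_comm, hi]
    rw [← e2, h1, ← hG0, ← e1, Nat.cast_mul, div_mul_cancel_left₀]
    exact_mod_cast Nat.card_pos.ne'
  have hii : ∀ s, IntervalIntegrable
      (fun t : ℝ => if t + 1 ≤ truncMin (i s) (t + 1) then (1 : ℝ) else 0)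
      MeasureTheory.volume 0 u := fun s => by
    refine Antitone.intervalIntegrable fun t t' h => ?_
    simp only [le_truncMin_iff]
    have h2 : ((⌈t + 1⌉.toNat : ℕ) : ℕ∞) ≤ (⌈t' + 1⌉.toNat : ℕ) := by
      exact_mod_cast Int.toNat_le_toNat (Int.ceil_mono (by linarith))
    by_cases h3 : ((⌈t' + 1⌉.toNat : ℕ) : ℕ∞) ≤ i s
    · rw [if_pos h3, if_pos (h2.trans h3)]
    · rw [if_neg h3]; split_ifs <;> norm_num
  rw [herbrandPhi]
  simp_rw [hint]
  rw [intervalIntegral.integral_div, intervalIntegral.integral_finsetSum fun s _ => hii s,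
    Finset.sum_congr rfl fun s hs => integral_truncMin (Finset.mem_filter.1 hs).2 u,
    Finset.sum_sub_distrib, Finset.sum_const, shiftedPhi]
  have e3 : (((Finset.univ.filter fun s => 1 ≤ i s).card • 1 : ℝ)) = truncSum i 1 := by
    rw [nsmul_one]
    simp only [truncSum, truncMin_one, Finset.sum_boole]
  -- The elements outside of inertia do not contribute, as `0 ≤ u + 1`.
  have e4 : ∑ s with 1 ≤ i s, truncMin (i s) (u + 1) = truncSum i (u + 1) := by
    rw [truncSum, Finset.sum_filter]
    refine Finset.sum_congr rfl fun s _ => ?_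
    split_ifs with h
    · rfl
    · have : i s = ((0 : ℕ) : ℕ∞) := by simpa [Order.one_le_iff_ne_zero] using h
      rw [this, truncMin_coe, Nat.cast_zero, min_eq_left (by linarith)]
  rw [e3, e4, sub_div, div_self hpos.ne', sub_add_cancel]

theorem bijOn_herbrandPhi : Set.BijOn (herbrandPhi F K L) (Set.Ici (-1)) (Set.Ici (-1)) := by
  have hb := bijOn_shiftedPhi (galoisIndex_one F K L)
  have he : ∀ u ∈ Set.Ici (-1 : ℝ), herbrandPhi F K L u =
      shiftedPhi (galoisIndex F K L) (u + 1) - 1 := fun u hu => by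
    rw [← herbrandPhi_add_one F K L hu, add_sub_cancel_right]
  refine ⟨fun u hu => ?_, fun u hu v hv h => ?_, fun v hv => ?_⟩
  · rw [he u hu, Set.mem_Ici]
    have := hb.mapsTo (show u + 1 ∈ Set.Ici (0 : ℝ) by simp at hu ⊢; linarith)
    simp at this; linarith
  · rw [he u hu, he v hv] at h
    have := (strictMono_shiftedPhi (galoisIndex_one F K L)).injective (sub_left_injective h)
    linarith
  · obtain ⟨r, hr, h⟩ := hb.surjOn (show v + 1 ∈ Set.Ici (0 : ℝ) by simp at hv ⊢; linarith)
    have hr1 : r - 1 ∈ Set.Ici (-1 : ℝ) := by simp at hr ⊢; linarith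
    exact ⟨r - 1, hr1, by rw [he _ hr1, sub_add_cancel, h, add_sub_cancel_right]⟩

theorem strictMonoOn_herbrandPhi : StrictMonoOn (herbrandPhi F K L) (Set.Ici (-1)) := by
  intro u hu v hv h
  have := strictMono_shiftedPhi (galoisIndex_one F K L) (show u + 1 < v + 1 by linarith)
  rw [← herbrandPhi_add_one F K L hu, ← herbrandPhi_add_one F K L hv] at this
  linarith

theorem herbrandPhi_zero : herbrandPhi F K L 0 = 0 := by simp [herbrandPhi]

theorem herbrandPhi_herbrandPsi {v : ℝ} (hv : -1 ≤ v) :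
    herbrandPhi F K L (herbrandPsi F K L v) = v :=
  (bijOn_herbrandPhi F K L).surjOn.rightInvOn_invFunOn hv

theorem neg_one_le_herbrandPsi {v : ℝ} (hv : -1 ≤ v) : -1 ≤ herbrandPsi F K L v :=
  (bijOn_herbrandPhi F K L).surjOn.mapsTo_invFunOn hv

theorem herbrandPsi_herbrandPhi {u : ℝ} (hu : -1 ≤ u) :
    herbrandPsi F K L (herbrandPhi F K L u) = u :=
  (bijOn_herbrandPhi F K L).injOn.leftInvOn_invFunOn hu

theorem herbrandPsi_zero : herbrandPsi F K L 0 = 0 := by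
  conv_lhs => rw [← herbrandPhi_zero F K L]
  exact herbrandPsi_herbrandPhi F K L (by norm_num)

theorem strictMonoOn_herbrandPsi : StrictMonoOn (herbrandPsi F K L) (Set.Ici (-1)) := by
  intro u hu v hv h
  rw [← (strictMonoOn_herbrandPhi F K L).lt_iff_lt (neg_one_le_herbrandPsi F K L hu)
    (neg_one_le_herbrandPsi F K L hv), herbrandPhi_herbrandPsi F K L hu,
    herbrandPhi_herbrandPsi F K L hv]
  exact h

theorem herbrandPsi_nonneg {v : ℝ} (hv : 0 ≤ v) : 0 ≤ herbrandPsi F K L v := by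
  rw [← herbrandPsi_zero F K L]
  exact (strictMonoOn_herbrandPsi F K L).monotoneOn (by simp) (by simp; linarith) hv

theorem herbrandPhi_nonneg {v : ℝ} (hv : 0 ≤ v) : 0 ≤ herbrandPhi F K L v := by
  rw [← herbrandPhi_zero F K L]
  exact (strictMonoOn_herbrandPhi F K L).monotoneOn (by simp) (by simp; linarith) hv

end GaloisIndex

/-! ### Upper numbering in a tower -/

section GaloisTower

open IsLocalRing

variable (F : Type*) [Field F] [ValuativeRel F] [TopologicalSpace F] [IsNonarchimedeanLocalField F]
  (K M L : Type*) [Field K] [Field M] [Field L] [Algebra F K] [Algebra F M] [Algebra F L]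
  [Algebra K M] [Algebra K L] [Algebra M L]
  [IsScalarTower F K M] [IsScalarTower F K L] [IsScalarTower F M L] [IsScalarTower K M L]
  [FiniteDimensional F M] [Algebra.IsSeparable F M] [FiniteDimensional F L]
  [Algebra.IsSeparable F L] [FiniteDimensional K M] [FiniteDimensional K L] [FiniteDimensional M L]
  [IsGalois K L] [Normal K M]

attribute [local instance] integralClosureAlgebra

/-- The relations hold in a tower `L / M / K`: the valuation rings are monogenic over `𝒪[F]`, which
gives the formula for the index function of the quotient. -/
theorem isIndexedExtension_galoisIndex :
    IsIndexedExtension (AlgEquiv.restrictNormalHom M : Gal(L/K) →* Gal(M/K))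
      (AlgEquiv.restrictScalarsHom K : Gal(L/M) →* Gal(L/K))
      (galoisIndex F K L) (galoisIndex F M L) (galoisIndex F K M) where
  surjective := AlgEquiv.restrictNormalHom_surjective L
  injective := AlgEquiv.restrictScalars_injective K
  range_eq := by
    ext s
    rw [MonoidHom.mem_ker]
    constructor
    · rintro ⟨t, rfl⟩
      ext x
      apply (algebraMap M L).injective
      exact (AlgEquiv.restrictNormal_commutes _ M x).trans (t.commutes x)
    · intro hs
      refine ⟨AlgEquiv.ofRingEquiv (f := s.toRingEquiv) fun x => ?_, rfl⟩
      refine (AlgEquiv.restrictNormal_commutes s M x).symm.trans ?_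
      exact congrArg (algebraMap M L) (DFunLike.congr_fun hs x)
  one := galoisIndex_one F K L
  comp _ := rfl
  mul_eq := lowerIndex_mul_eq_min
  sum_eq s := by
    have : IsGalois M L := IsGalois.tower_top_of_isGalois K M L
    have := isGaloisGroup_integralClosure F M L
    have : IsScalarTower 𝒪[F] (integralClosure 𝒪[F] M) (integralClosure 𝒪[F] L) :=
      .of_algebraMap_eq' (integralClosureMap F M L).comp_algebraMap.symm
    have := finite_integralClosure F L
    have : Module.Finite (integralClosure 𝒪[F] M) (integralClosure 𝒪[F] L) :=
      Module.Finite.of_restrictScalars_finite 𝒪[F] _ _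
    have := finite_residueField_integralClosure F M
    have : FaithfulSMul (integralClosure 𝒪[F] M) (integralClosure 𝒪[F] L) := by
      rw [faithfulSMul_iff_algebraMap_injective]
      intro x y h
      exact Subtype.ext ((algebraMap M L).injective (congrArg Subtype.val h))
    have h := card_inertia_mul_lowerIndex (A := 𝒪[F]) (H := Gal(L/M))
      (exists_adjoin_eq_integralClosure F L) (exists_adjoin_eq_integralClosure F M)
      (AlgEquiv.restrictScalarsHom K : Gal(L/M) →* Gal(L/K)) (fun t c => rfl) s
      (AlgEquiv.restrictNormalHom M s) (fun b => Subtype.ext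
        (AlgEquiv.restrictNormal_commutes s M (b : M)).symm)
    have e : Nat.card ((maximalIdeal (integralClosure 𝒪[F] L)).inertia Gal(L/M)) =
        Nat.card {t | 1 ≤ galoisIndex F M L t} := by
      refine Nat.card_congr (Equiv.subtypeEquivRight fun t => ?_)
      have := le_lowerIndex_iff (C := integralClosure 𝒪[F] L) 1 t
      rw [pow_one] at this
      exact this.symm
    rw [← e]
    exact h

/-- Transitivity of the Herbrand functions in a tower `L / M / K`. -/
theorem herbrandPhi_comp {u : ℝ} (hu : -1 ≤ u) :
    herbrandPhi F K M (herbrandPhi F M L u) = herbrandPhi F K L u := by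
  have h := (isIndexedExtension_galoisIndex F K M L).shiftedPhi_comp (u + 1)
  rw [← herbrandPhi_add_one F K L hu, ← herbrandPhi_add_one F M L hu,
    ← herbrandPhi_add_one F K M ((bijOn_herbrandPhi F M L).mapsTo hu)] at h
  linarith

theorem herbrandPsi_comp {v : ℝ} (hv : -1 ≤ v) :
    herbrandPsi F M L (herbrandPsi F K M v) = herbrandPsi F K L v := by
  have h1 := neg_one_le_herbrandPsi F K M hv
  have h2 := neg_one_le_herbrandPsi F M L h1
  rw [← herbrandPsi_herbrandPhi F K L h2, ← herbrandPhi_comp F K M L h2,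
    herbrandPhi_herbrandPsi F M L h1, herbrandPhi_herbrandPsi F K M hv]

/-- The upper numbering is compatible with quotients. -/
theorem upperRamification_map_le {v : ℝ} (hv : -1 ≤ v) :
    upperRamification F K L v ≤
      (upperRamification F K M v).comap (AlgEquiv.restrictNormalHom M) := by
  intro s hs
  rw [upperRamification, mem_lowerRamification_iff, ← herbrandPsi_comp F K M L hv] at hs
  have h1 := neg_one_le_herbrandPsi F K M hv
  have h2 := neg_one_le_herbrandPsi F M L h1
  have h := ((isIndexedExtension_galoisIndex F K M L).shiftedPhi_le_truncMin_iff
    (AlgEquiv.restrictNormalHom M s) _).2 ⟨s, rfl, hs⟩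
  rw [← herbrandPhi_add_one F M L h2, herbrandPhi_herbrandPsi F M L h1] at h
  rw [Subgroup.mem_comap, upperRamification, mem_lowerRamification_iff]
  exact h

/-- The upper numbering in a subgroup is obtained by means of `ψ`. -/
theorem upperRamification_comap_restrictScalars {v : ℝ} (hv : -1 ≤ v) :
    (upperRamification F K L v).comap (AlgEquiv.restrictScalarsHom K : Gal(L/M) →* Gal(L/K)) =
      upperRamification F M L (herbrandPsi F K M v) := by
  rw [upperRamification, upperRamification, herbrandPsi_comp F K M L hv]
  rfl

end GaloisTower

/-! ### The image of inflation -/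

section Inflation

variable {𝔤 A : Type*} [Group 𝔤] [TopologicalSpace 𝔤] [Group A] [MulDistribMulAction 𝔤 A]

theorem Cocycle.apply_one (α : Cocycle 𝔤 A) : α.toFun 1 = 1 := by
  have h := α.map_mul 1 1
  rw [mul_one, one_smul] at h
  exact mul_eq_left.1 h.symm

/-- A class is inflated from `𝔤 ⧸ N` with the coefficients `A ^ N` if and only if its restriction to
`N` is trivial. -/
theorem mem_range_inflation_iff (hA : ∀ a : A, IsLocallyConstant fun g : 𝔤 => g • a)
    (N : Subgroup 𝔤) [N.Normal] (α : Cocycle 𝔤 A) :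
    (Quotient.mk _ α : H1 𝔤 A) ∈ Set.range (H1.inflation (A := A) N) ↔
      ∃ a : A, ∀ n ∈ N, α.toFun n = a * (n • a)⁻¹ := by
  constructor
  · rintro ⟨β, hβ⟩
    induction β using Quotient.inductionOn with
    | h β =>
      obtain ⟨a, ha⟩ := Quotient.exact hβ
      refine ⟨a⁻¹, fun n hn => ?_⟩
      have h1 : ((n : 𝔤) : 𝔤 ⧸ N) = 1 := (QuotientGroup.eq_one_iff n).2 hn
      have h2 : (Cocycle.inflation N β).toFun n = 1 := by
        change (β.toFun (n : 𝔤 ⧸ N) : A) = 1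
        rw [h1, β.apply_one]
        rfl
      rw [ha, h2, smul_inv', inv_inv, mul_one]
  · rintro ⟨a, ha⟩
    let b : 𝔤 → A := fun g => a⁻¹ * α.toFun g * g • a
    have hb : ∀ g h, b (g * h) = b g * g • b h := fun g h => by
      simp only [b, α.map_mul, smul_mul', mul_smul, smul_inv']
      group
    have hbN : ∀ n ∈ N, b n = 1 := fun n hn => by simp only [b, ha n hn]; group
    have hbr : ∀ g, ∀ n ∈ N, b (g * n) = b g := fun g n hn => by
      rw [hb, hbN n hn, smul_one, mul_one]
    have hfix : ∀ g, b g ∈ FixedPoints.subgroup N A := fun g n => by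
      have h1 : b (n * g) = (n : 𝔤) • b g := by rw [hb, hbN n n.2, one_mul]
      have h2 : (n : 𝔤) * g = g * (g⁻¹ * n * g) := by group
      have h3 : g⁻¹ * n * g ∈ N := by
        simpa using Subgroup.Normal.conj_mem inferInstance (n : 𝔤) n.2 g⁻¹
      rw [h2, hbr g _ h3] at h1
      exact h1.symm
    have hloc : IsLocallyConstant b := (IsLocallyConstant.const a⁻¹ |>.mul α.continuous).mul (hA a)
    have hrel : ∀ g h : 𝔤, (QuotientGroup.leftRel N).r g h →
        (⟨b g, hfix g⟩ : FixedPoints.subgroup N A) = ⟨b h, hfix h⟩ := fun g h hgh => by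
      have h1 := hbr g _ (QuotientGroup.leftRel_apply.1 hgh)
      rw [mul_inv_cancel_left] at h1
      exact Subtype.ext h1.symm
    let β : Cocycle (𝔤 ⧸ N) (FixedPoints.subgroup N A) :=
      { toFun := fun q => Quotient.lift (fun g => ⟨b g, hfix g⟩) hrel q
        map_mul := by
          rintro ⟨g⟩ ⟨h⟩
          exact Subtype.ext (hb g h)
        continuous := fun s => by
          refine (QuotientGroup.isQuotientMap_mk (N := N)).isOpen_preimage.1 ?_
          convert! hloc (Subtype.val '' s) using 1
          ext g
          constructor
          · exact fun hg => ⟨_, hg, rfl⟩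
          · rintro ⟨y, hy, hyg⟩
            obtain rfl : y = ⟨b g, hfix g⟩ := Subtype.ext hyg
            exact hy }
    exact ⟨Quotient.mk _ β, Quotient.sound ⟨a⁻¹, fun g => by
      change α.toFun g = a⁻¹⁻¹ * (a⁻¹ * α.toFun g * g • a) * g • a⁻¹
      rw [smul_inv']
      group⟩⟩

end Inflation

/-! ### Shapiro's lemma on a normal subgroup -/

section Shapiro

variable {𝔤 𝔥 : Type*} [Group 𝔤] [TopologicalSpace 𝔤] [IsTopologicalGroup 𝔤] [Group 𝔥]
  [TopologicalSpace 𝔥] {ι : 𝔥 →* 𝔤} {A : Type*} [Group A] [MulDistribMulAction 𝔥 A]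

/-- Shapiro's lemma for the restriction to a normal subgroup `N` of `𝔤`: a cocycle with values in
an induced group is trivial on `N` if and only if its Shapiro transform is trivial on the inverse
image of `N` in `𝔥`. A trivialisation `c` of the latter gives the trivialisation
`x ↦ α(x)(1)⁻¹ d(x)` of the former, where `d` is the function with `d(h r n) = α(h)(1) ʰc` for `h`
in `𝔥`, `n` in `N` and `r` in a system of representatives of the double cosets `𝔥 \ 𝔤 / N`. -/
theorem exists_trivialization_iff (α : Cocycle 𝔤 (Induced ι A)) (N : Subgroup 𝔤) [N.Normal]
    (hsmooth : Function.Surjective (Induced.evalOne ι A)) (hopen : IsOpen (ι.range : Set 𝔤))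
    (hnhds : ∀ U : Subgroup 𝔤, IsOpen (U : Set 𝔤) →
      ∃ V : Subgroup 𝔤, V.Normal ∧ IsOpen (V : Set 𝔤) ∧ V ≤ U) :
    (∃ a : Induced ι A, ∀ n ∈ N, α.toFun n = a * (n • a)⁻¹) ↔
      ∃ c : A, ∀ h : 𝔥, ι h ∈ N → (α.toFun (ι h)).val 1 = c * (h • c)⁻¹ := by
  constructor
  · rintro ⟨a, ha⟩
    refine ⟨a.val 1, fun h hh => ?_⟩
    rw [ha _ hh, Induced.val_mul, Induced.val_inv, Induced.val_smul_one]
  rintro ⟨c, hc⟩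
  obtain ⟨m, hm⟩ := hsmooth c
  have hm : m.val 1 = c := hm
  obtain ⟨U₀, hU₀, hmU⟩ := m.2.2
  have hcU : ∀ h : 𝔥, ι h ∈ U₀ → h • c = c := fun h hh => by
    have h1 : m.val (1 * ι h) = m.val 1 := hmU 1 _ hh
    rw [one_mul, ← mul_one (ι h), Induced.val_map_mul, hm] at h1
    exact h1
  -- The subgroup on which the cocycle is trivial is open.
  let U₁ : Subgroup 𝔤 :=
    { carrier := {g | α.toFun g = 1}
      one_mem' := α.apply_one
      mul_mem' := fun {g g'} hg hg' => by
        change α.toFun (g * g') = 1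
        rw [α.map_mul, show α.toFun g = 1 from hg, show α.toFun g' = 1 from hg', smul_one, mul_one]
      inv_mem' := fun {g} hg => by
        have h := α.map_mul g⁻¹ g
        rw [inv_mul_cancel, α.apply_one, show α.toFun g = 1 from hg, smul_one, mul_one] at h
        exact h.symm }
  have hU₁ : IsOpen (U₁ : Set 𝔤) := α.continuous.isOpen_fiber 1
  obtain ⟨V, hVn, hVo, hV⟩ := hnhds (U₀ ⊓ U₁ ⊓ ι.range) ((hU₀.inter hU₁).inter hopen)
  let f : 𝔥 → A := fun h => (α.toFun (ι h)).val 1 * h • c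
  have hf : ∀ h k, f (h * k) = (α.toFun (ι h)).val 1 * h • f k := fun h k => by
    simp only [f, map_mul, α.map_mul, Induced.val_mul, Induced.val_smul_one, smul_mul', mul_smul,
      mul_assoc]
  have hfN : ∀ k, ι k ∈ N → f k = c := fun k hk => by simp only [f, hc k hk, inv_mul_cancel_right]
  have hfV : ∀ k, ι k ∈ V → f k = c := fun k hk => by
    have h1 : α.toFun (ι k) = 1 := (hV hk).1.2
    simp only [f, h1, hcU k (hV hk).1.1, Induced.val_one, one_mul]
  have hfmul : ∀ h k, f k = c → f (h * k) = f h := fun h k hk => by rw [hf, hk]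
  -- The double cosets `𝔥 x N` and their representatives.
  let R : Setoid 𝔤 :=
    { r := fun x y => ∃ h : 𝔥, ∃ n ∈ N, y = ι h * x * n
      iseqv :=
        { refl := fun x => ⟨1, 1, one_mem _, by simp⟩
          symm := by
            rintro x y ⟨h, n, hn, rfl⟩
            exact ⟨h⁻¹, n⁻¹, inv_mem hn, by rw [map_inv]; group⟩
          trans := by
            rintro x y z ⟨h, n, hn, rfl⟩ ⟨h', n', hn', rfl⟩
            exact ⟨h' * h, n * n', mul_mem hn hn', by rw [map_mul]; group⟩ } }
  let r : 𝔤 → 𝔤 := fun x => (Quotient.mk R x).out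
  have hr : ∀ x y, R.r x y → r x = r y := fun x y h =>
    congrArg Quotient.out (Quotient.sound (s := R) h)
  have hex : ∀ x, ∃ h : 𝔥, ∃ n ∈ N, x = ι h * r x * n := fun x =>
    Quotient.exact (s := R) (Quotient.out_eq (Quotient.mk R x))
  choose η ν hν hην using hex
  let d : 𝔤 → A := fun x => f (η x)
  -- As `N` is normal, `h` is determined by `h r n` up to elements of the inverse image of `N`.
  have hd : ∀ x h n, n ∈ N → x = ι h * r x * n → d x = f h := fun x h n hn hx => by
    have h1 : ι (h⁻¹ * η x) ∈ N := by
      have h2 : ι (h⁻¹ * η x) = r x * (n * (ν x)⁻¹) * (r x)⁻¹ := by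
        have h3 := hx.symm.trans (hην x)
        rw [map_mul, map_inv, inv_mul_eq_iff_eq_mul]
        have h4 : ι (η x) = ι (η x) * r x * ν x * (ν x)⁻¹ * (r x)⁻¹ := by group
        rw [h4, ← h3]
        group
      rw [h2]
      exact Subgroup.Normal.conj_mem inferInstance _ (mul_mem hn (inv_mem (hν x))) _
    have h5 := hfmul h _ (hfN _ h1)
    rw [mul_inv_cancel_left] at h5
    exact h5
  have hdN : ∀ x n, n ∈ N → d (x * n) = d x := fun x n hn => by
    have h1 : r (x * n) = r x := (hr _ _ ⟨1, n, hn, by simp⟩).symm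
    refine hd _ (η x) (ν x * n) (mul_mem (hν x) hn) ?_
    rw [h1, ← mul_assoc, ← hην x]
  have hdι : ∀ h x, d (ι h * x) = (α.toFun (ι h)).val 1 * h • d x := fun h x => by
    have h1 : r (ι h * x) = r x := (hr _ _ ⟨h, 1, one_mem _, by simp⟩).symm
    rw [hd _ (h * η x) (ν x) (hν x), hf]
    rw [h1, map_mul, mul_assoc (ι h), mul_assoc (ι h), ← hην x]
  -- As `V` is normal and contained in the image of `𝔥`, translation by `V` moves only `h`.
  have hdV : ∀ x v, v ∈ V → d (x * v) = d x := fun x v hv => by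
    have hv' : r x * ν x * v * (r x * ν x)⁻¹ ∈ V := hVn.conj_mem v hv _
    obtain ⟨k, hk⟩ := (hV hv').2
    have h2 : x * v = ι (η x * k) * r x * ν x := by
      conv_lhs => rw [hην x]
      rw [map_mul, hk]
      group
    have h1 : r (x * v) = r x := by
      refine (hr _ _ ⟨η x * k * (η x)⁻¹, 1, one_mem _, ?_⟩).symm
      rw [h2, map_mul, map_mul, map_mul, map_inv]
      conv_rhs => lhs; rhs; rw [hην x]
      group
    rw [hd _ (η x * k) (ν x) (hν x) (h1.symm ▸ h2)]
    exact hfmul _ _ (hfV k (hk ▸ hv'))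
  have hval : ∀ x g, (α.toFun (x * g)).val 1 = (α.toFun x).val 1 * (α.toFun g).val x :=
      fun x g => by
    rw [α.map_mul, Induced.val_mul, Induced.val_smul, one_mul]
  clear_value d
  let a : Induced ι A := ⟨fun x => ((α.toFun x).val 1)⁻¹ * d x, fun h x => by
      dsimp only
      rw [hdι, α.map_mul, Induced.val_mul, Induced.val_smul_one, smul_mul', smul_inv']
      group, V, hVo, fun x v hv => by
      dsimp only
      have h1 : α.toFun v = 1 := (hV hv).1.2
      rw [hdV x v hv, hval, h1, Induced.val_one, mul_one]⟩
  have ha : ∀ x, a.val x = ((α.toFun x).val 1)⁻¹ * d x := fun x => rfl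
  refine ⟨a, fun n hn => Induced.ext fun x => ?_⟩
  rw [Induced.val_mul, Induced.val_inv, Induced.val_smul, ha, ha, hdN x n hn, hval]
  group

end Shapiro

/-! ### Upper numbering of absolute Galois groups -/

section AbsoluteRamification

variable (F : Type*) [Field F] [ValuativeRel F] [TopologicalSpace F] [IsNonarchimedeanLocalField F]
  (K Ω : Type*) [Field K] [Field Ω] [Algebra F K] [Algebra F Ω] [Algebra K Ω]
  [IsScalarTower F K Ω] [FiniteDimensional F K] [Algebra.IsSeparable F Ω]

theorem finiteDimensional_of_finiteDimensional_top (M L : Type*) [Field M] [Field L] [Algebra F M]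
    [Algebra F L] [Algebra M L] [IsScalarTower F M L] [FiniteDimensional F L] :
    FiniteDimensional F M :=
  FiniteDimensional.of_injective (IsScalarTower.toAlgHom F M L).toLinearMap
    (algebraMap M L).injective

instance isScalarTower_intermediateField_top (L : IntermediateField K Ω) : IsScalarTower F L Ω :=
  .of_algebraMap_eq fun _ => rfl

/-- The upper numbering filtrations of the finite Galois extensions of `K` in `Ω` are compatible. -/
theorem restrictNormalHom_mem_upperRamification (M L : Type*) [Field M] [Field L] [Algebra F M]
    [Algebra F L] [Algebra K M] [Algebra K L] [Algebra M L] [Algebra M Ω] [Algebra L Ω]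
    [IsScalarTower F K M] [IsScalarTower F K L] [IsScalarTower F M L] [IsScalarTower K M L]
    [IsScalarTower F L Ω] [IsScalarTower K M Ω] [IsScalarTower K L Ω] [IsScalarTower M L Ω]
    [FiniteDimensional F L] [IsGalois K L] [Normal K M] {v : ℝ} (hv : -1 ≤ v) {σ : Gal(Ω/K)}
    (hσ : AlgEquiv.restrictNormalHom L σ ∈ upperRamification F K L v) :
    AlgEquiv.restrictNormalHom M σ ∈ upperRamification F K M v := by
  have := finiteDimensional_of_finiteDimensional_top F M L
  have : Algebra.IsSeparable F L := Algebra.isSeparable_tower_bot_of_isSeparable F L Ω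
  have : Algebra.IsSeparable F M := Algebra.isSeparable_tower_bot_of_isSeparable F M L
  have : FiniteDimensional K L := FiniteDimensional.right F K L
  have : FiniteDimensional K M := FiniteDimensional.right F K M
  have : FiniteDimensional M L := FiniteDimensional.right F M L
  have h := upperRamification_map_le F K M L hv hσ
  rw [Subgroup.mem_comap] at h
  convert! h using 1
  ext x
  apply (algebraMap M Ω).injective
  refine (AlgEquiv.restrictNormal_commutes σ M x).trans ?_
  rw [IsScalarTower.algebraMap_apply M L Ω x, IsScalarTower.algebraMap_apply M L Ω]
  refine (AlgEquiv.restrictNormal_commutes σ L _).symm.trans (congrArg (algebraMap L Ω)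
    (AlgEquiv.restrictNormal_commutes (AlgEquiv.restrictNormalHom L σ) M x).symm)

theorem upperRamification_antitoneOn (L : Type*) [Field L] [Algebra F L] [Algebra K L]
    [IsScalarTower F K L] [FiniteDimensional F L] [Algebra.IsSeparable F L]
    [FiniteDimensional K L] :
    AntitoneOn (upperRamification F K L) (Set.Ici (-1)) := fun _ hu _ hv h =>
  lowerRamification_antitone F K L ((strictMonoOn_herbrandPsi F K L).monotoneOn hu hv h)

theorem absRamification_antitoneOn :
    AntitoneOn (absRamification F K Ω) (Set.Ici (-1)) := fun u hu v hv h =>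
  iInf_mono fun L => Subgroup.comap_mono (by
    have : FiniteDimensional F L := FiniteDimensional.trans F K L
    have : Algebra.IsSeparable F L := Algebra.isSeparable_tower_bot_of_isSeparable F L Ω
    exact upperRamification_antitoneOn F K L hu hv h)

/-- An element of `Γ_K^v` restricts to an element of `Gal(L / K)^v` for each finite
Galois extension `L` of `K` that comes with an embedding in `Ω`. -/
theorem mem_upperRamification_of_mem_absRamification (L : Type*) [Field L]
    [Algebra F L] [Algebra K L] [Algebra L Ω] [IsScalarTower F K L] [IsScalarTower F L Ω]
    [IsScalarTower K L Ω] [FiniteDimensional F L] [IsGalois K L] {v : ℝ} (hv : -1 ≤ v)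
    {σ : Gal(Ω/K)} (hσ : σ ∈ absRamification F K Ω v) :
    AlgEquiv.restrictNormalHom L σ ∈ upperRamification F K L v := by
  let e := AlgEquiv.ofInjectiveField (IsScalarTower.toAlgHom K L Ω)
  have : FiniteDimensional K L := FiniteDimensional.right F K L
  let L' : FiniteGaloisIntermediateField K Ω :=
    { toIntermediateField := (IsScalarTower.toAlgHom K L Ω).fieldRange
      finiteDimensional := e.toLinearEquiv.finiteDimensional
      isGalois := IsGalois.of_algEquiv e }
  let : Algebra L L' := e.toRingEquiv.toRingHom.toAlgebra
  have : IsScalarTower K L L' := .of_algebraMap_eq fun x => (e.commutes x).symm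
  have : IsScalarTower L L' Ω := .of_algebraMap_eq fun x => rfl
  have : IsScalarTower F L L' := .of_algebraMap_eq fun x => Subtype.ext
    (IsScalarTower.algebraMap_apply F L Ω x)
  have : FiniteDimensional K L' := L'.finiteDimensional
  have : IsGalois K L' := L'.isGalois
  have : FiniteDimensional F L' := FiniteDimensional.trans F K L'
  exact restrictNormalHom_mem_upperRamification F K Ω L L' hv
    (Subgroup.mem_iInf.1 hσ L')

variable [Normal F Ω]

/-- `Γ_F^v ∩ Γ_E = Γ_E^{ψ(v)}`. -/
theorem absRamification_comap_restrictScalars (E : Type*) [Field E] [Algebra F E] [Algebra E Ω]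
    [IsScalarTower F E Ω] [FiniteDimensional F E] [Normal F E] {v : ℝ} (hv : -1 ≤ v) :
    (absRamification F F Ω v).comap (AlgEquiv.restrictScalarsHom F : Gal(Ω/E) →* Gal(Ω/F)) =
      absRamification F E Ω (herbrandPsi F F E v) := by
  have : IsGalois F Ω := { }
  have : Algebra.IsSeparable F E := Algebra.isSeparable_tower_bot_of_isSeparable F E Ω
  have hψ := neg_one_le_herbrandPsi F F E hv
  -- Each finite extension of `E` in `Ω` lies in a finite Galois extension of `F`.
  have key : ∀ (L : IntermediateField E Ω) [FiniteDimensional E L], ∃ N : IntermediateField E Ω,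
      L ≤ N ∧ FiniteDimensional F N ∧ IsGalois F N := fun L _ => by
    have : FiniteDimensional F L := FiniteDimensional.trans F E L
    let N := IntermediateField.normalClosure F L Ω
    have hL : ∀ x ∈ L, x ∈ N := fun x hx =>
      (AlgHom.fieldRange_le_normalClosure (IsScalarTower.toAlgHom F L Ω)) ⟨⟨x, hx⟩, rfl⟩
    let N' : IntermediateField E Ω :=
      { N.toSubfield with
        algebraMap_mem' := fun x => hL _ (L.algebraMap_mem x) }
    refine ⟨N', hL, ?_, ?_⟩
    · exact inferInstanceAs (FiniteDimensional F N)
    · exact inferInstanceAs (IsGalois F N)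
  have comm : ∀ (N : IntermediateField E Ω) [FiniteDimensional F N] [IsGalois F N] [IsGalois E N]
      (σ : Gal(Ω/E)), AlgEquiv.restrictNormalHom N (AlgEquiv.restrictScalarsHom F σ) ∈
        upperRamification F F N v ↔
      AlgEquiv.restrictNormalHom N σ ∈ upperRamification F E N (herbrandPsi F F E v) :=
    fun N _ _ _ σ => by
    have : Algebra.IsSeparable F N := Algebra.isSeparable_tower_bot_of_isSeparable F N Ω
    have : FiniteDimensional E N := FiniteDimensional.right F E N
    rw [← upperRamification_comap_restrictScalars F F E N hv, Subgroup.mem_comap]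
    have e : AlgEquiv.restrictNormalHom N (AlgEquiv.restrictScalarsHom F σ) =
        AlgEquiv.restrictScalarsHom F (AlgEquiv.restrictNormalHom N σ) := by
      ext x
      exact (AlgEquiv.restrictNormal_commutes (AlgEquiv.restrictScalarsHom F σ) N x).trans
        (AlgEquiv.restrictNormal_commutes σ N x).symm
    rw [e]
  ext σ
  rw [Subgroup.mem_comap]
  constructor
  · intro hσ
    refine Subgroup.mem_iInf.2 fun L => Subgroup.mem_comap.2 ?_
    obtain ⟨N, hLN, hfin, hgal⟩ := key L.toIntermediateField
    have : IsGalois E N := IsGalois.tower_top_of_isGalois F E N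
    have h1 := (comm N σ).1 (mem_upperRamification_of_mem_absRamification F F Ω N hv hσ)
    let : Algebra L N := (IntermediateField.inclusion hLN).toRingHom.toAlgebra
    have : IsScalarTower E L N := .of_algebraMap_eq fun x => rfl
    have : IsScalarTower L N Ω := .of_algebraMap_eq fun x => rfl
    have : IsScalarTower F L N := .of_algebraMap_eq fun x => rfl
    exact restrictNormalHom_mem_upperRamification F E Ω L N hψ h1
  · intro hσ
    refine Subgroup.mem_iInf.2 fun L => Subgroup.mem_comap.2 ?_
    obtain ⟨S, hS⟩ : L.toIntermediateField.FG :=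
      IntermediateField.essFiniteType_iff.1 inferInstance
    have hL : FiniteDimensional E (IntermediateField.adjoin E (S : Set Ω)) :=
      IntermediateField.finiteDimensional_adjoin fun x _ =>
        (Algebra.IsIntegral.isIntegral (R := F) x).tower_top
    obtain ⟨N, hLN, hfin, hgal⟩ := key (IntermediateField.adjoin E (S : Set Ω))
    have : IsGalois E N := IsGalois.tower_top_of_isGalois F E N
    have h1 := (comm N σ).2 (mem_upperRamification_of_mem_absRamification F E Ω N hψ hσ)
    have hLN' : L.toIntermediateField ≤ N.restrictScalars F := by
      rw [← hS, IntermediateField.adjoin_le_iff]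
      exact fun x hx => hLN (IntermediateField.subset_adjoin E _ hx)
    let : Algebra L N := (IntermediateField.inclusion hLN').toRingHom.toAlgebra
    have : IsScalarTower F L N := .of_algebraMap_eq fun x => rfl
    have : IsScalarTower L N Ω := .of_algebraMap_eq fun x => rfl
    exact restrictNormalHom_mem_upperRamification F F Ω L N hv h1

end AbsoluteRamification

/-! ### The topology of the Weil group -/

section WeilTopology

variable (F : Type*) [Field F] [ValuativeRel F]

open Topology

theorem nhds_induced_bot {X Y : Type*} (f : X → Y) (x : X) :
    @nhds X (TopologicalSpace.induced f ⊥) x = Filter.comap f (pure (f x)) := by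
  let t : TopologicalSpace Y := ⊥
  have : DiscreteTopology Y := ⟨rfl⟩
  rw [nhds_induced, nhds_discrete]

/-- The neighbourhoods of `1` in the Weil group are those of inertia with the Krull topology. -/
theorem Weil.mem_nhds_one_iff (K Ω : Type*) [Field K] [Field Ω] [Algebra F K] [Algebra F Ω]
    [Algebra K Ω] [IsScalarTower F K Ω] (U : Set (Weil F K Ω)) :
    U ∈ 𝓝 (1 : Weil F K Ω) ↔ ∃ L : IntermediateField K Ω, FiniteDimensional K L ∧
      ∀ w : Weil F K Ω, (∀ x ∈ L, Weil.toGal F K Ω w x = x) → w ∈ Weil.inertia F K Ω → w ∈ U := by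
  have h1 : 𝓝 (1 : Weil F K Ω) = Filter.comap (Weil.toGal F K Ω) (𝓝 1) ⊓
      Filter.principal (Weil.inertia F K Ω : Set (Weil F K Ω)) := by
    refine (nhds_inf (t₁ := TopologicalSpace.induced (Weil.toGal F K Ω) inferInstance)
      (t₂ := TopologicalSpace.induced (QuotientGroup.mk' (Weil.inertia F K Ω)) ⊥)).trans ?_
    rw [nhds_induced_bot, nhds_induced, map_one, map_one, Filter.comap_pure]
    congr 2
    ext w
    exact QuotientGroup.eq_one_iff w
  rw [h1, Filter.mem_inf_principal, Filter.mem_comap]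
  constructor
  · rintro ⟨t, ht, hU⟩
    obtain ⟨L, hL, hLt⟩ := (krullTopology_mem_nhds_one_iff K Ω t).1 ht
    exact ⟨L, hL, fun w hw hi => hU (hLt ((IntermediateField.mem_fixingSubgroup_iff _ _).2 hw)) hi⟩
  · rintro ⟨L, hL, hU⟩
    exact ⟨L.fixingSubgroup, (krullTopology_mem_nhds_one_iff K Ω _).2 ⟨L, hL, subset_rfl⟩,
      fun w hw hi => hU w ((IntermediateField.mem_fixingSubgroup_iff _ _).1 hw) hi⟩

/-- The Weil group has a basis of neighbourhoods of `1` consisting of open normal subgroups. -/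
theorem Weil.exists_normal_le (K Ω : Type*) [Field K] [Field Ω] [Algebra F K] [Algebra F Ω]
    [Algebra K Ω] [IsScalarTower F K Ω] [IsGalois K Ω] (U : Subgroup (Weil F K Ω))
    (hU : IsOpen (U : Set (Weil F K Ω))) :
    ∃ V : Subgroup (Weil F K Ω), V.Normal ∧ IsOpen (V : Set (Weil F K Ω)) ∧ V ≤ U := by
  obtain ⟨L, hL, h⟩ := (Weil.mem_nhds_one_iff F K Ω _).1 (hU.mem_nhds U.one_mem)
  let N := IntermediateField.normalClosure K L Ω
  have hN : IsGalois K N := inferInstance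
  refine ⟨N.fixingSubgroup.comap (Weil.toGal F K Ω) ⊓ Weil.inertia F K Ω, inferInstance, ?_, ?_⟩
  · refine Subgroup.isOpen_of_mem_nhds _ (g := 1) ((Weil.mem_nhds_one_iff F K Ω _).2
      ⟨N, inferInstance, fun w hw hi => ⟨?_, hi⟩⟩)
    exact (IntermediateField.mem_fixingSubgroup_iff _ _).2 hw
  · rintro w ⟨hw, hi⟩
    exact h w (fun x hx => (IntermediateField.mem_fixingSubgroup_iff _ _).1 hw x
      (L.le_normalClosure hx)) hi

variable (E Ω : Type*) [Field E] [Field Ω] [Algebra F E] [Algebra F Ω] [Algebra E Ω]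
  [IsScalarTower F E Ω] [FiniteDimensional F E]

theorem Weil.isOpenMap_toBase : IsOpenMap (Weil.toBase F E Ω) := by
  rw [IsTopologicalGroup.isOpenMap_iff_nhds_one]
  intro U hU
  rw [Filter.mem_map] at hU
  obtain ⟨L, hL, h⟩ := (Weil.mem_nhds_one_iff F E Ω _).1 hU
  refine (Weil.mem_nhds_one_iff F F Ω U).2
    ⟨L.restrictScalars F, FiniteDimensional.trans F E L, fun w hw hi => ?_⟩
  let σ : Gal(Ω/E) := AlgEquiv.ofRingEquiv (f := (Weil.toGal F F Ω w).toRingEquiv)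
    fun x => hw _ (L.algebraMap_mem x)
  exact h ⟨σ, w.2⟩ (fun x hx => hw x hx) hi

end WeilTopology

/-! ### Ramification groups of the Weil group -/

section WeilRamification

variable (F : Type*) [Field F] [ValuativeRel F] [TopologicalSpace F] [IsNonarchimedeanLocalField F]
  (E Ω : Type*) [Field E] [Field Ω] [Algebra F E] [Algebra F Ω] [Algebra E Ω]
  [IsScalarTower F E Ω] [FiniteDimensional F E] [IsGalois F E] [IsSepClosure F Ω]

theorem Weil.ramification_comap_toBase {v : ℝ} (hv : -1 ≤ v) :
    (Weil.ramification F F Ω v).comap (Weil.toBase F E Ω) =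
      Weil.ramification F E Ω (herbrandPsi F F E v) := by
  have : IsGalois F Ω := inferInstance
  rw [Weil.ramification, Weil.ramification, ← absRamification_comap_restrictScalars F Ω E hv]
  rfl

/-- The subgroup generated by the groups `W_K^s`, `s > r`, is their union. -/
theorem Weil.coe_iSup_ramification (K Ω : Type*) [Field K] [Field Ω] [Algebra F K] [Algebra F Ω]
    [Algebra K Ω] [IsScalarTower F K Ω] [FiniteDimensional F K] [Algebra.IsSeparable F Ω] {r : ℝ}
    (hr : -1 ≤ r) :
    ((⨆ s : Set.Ioi r, Weil.ramification F K Ω s : Subgroup (Weil F K Ω)) : Set (Weil F K Ω)) =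
      ⋃ s : Set.Ioi r, (Weil.ramification F K Ω s : Set (Weil F K Ω)) := by
  refine Subgroup.coe_iSup_of_directed (Antitone.directed_le ?_)
  intro s t hst
  exact Subgroup.comap_mono (absRamification_antitoneOn F K Ω (hr.trans s.2.le)
    (hr.trans t.2.le) hst)

/-- `W_F^{r+} ∩ W_E = W_E^{ψ(r)+}`. -/
theorem Weil.ramificationPlus_comap_toBase {r : ℝ} (hr : -1 ≤ r) :
    (Weil.ramificationPlus F F Ω r).comap (Weil.toBase F E Ω) =
      Weil.ramificationPlus F E Ω (herbrandPsi F F E r) := by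
  have : IsGalois F Ω := inferInstance
  have hψ := neg_one_le_herbrandPsi F F E hr
  apply SetLike.coe_injective
  rw [Subgroup.coe_comap, Weil.ramificationPlus, Weil.ramificationPlus,
    Subgroup.topologicalClosure_coe, Subgroup.topologicalClosure_coe,
    (Weil.isOpenMap_toBase F E Ω).preimage_closure_eq_closure_preimage
      (Weil.continuous_toBase F E Ω), Weil.coe_iSup_ramification F F Ω hr,
    Weil.coe_iSup_ramification F E Ω hψ, Set.preimage_iUnion]
  congr 1
  ext w
  simp only [Set.mem_iUnion]
  constructor
  · rintro ⟨⟨s, hs⟩, hw⟩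
    have hs1 : -1 ≤ s := hr.trans hs.le
    refine ⟨⟨herbrandPsi F F E s, strictMonoOn_herbrandPsi F F E hr hs1 hs⟩, ?_⟩
    rw [← Weil.ramification_comap_toBase F E Ω hs1]
    exact hw
  · rintro ⟨⟨s, hs⟩, hw⟩
    have hs1 : -1 ≤ s := hψ.trans hs.le
    refine ⟨⟨herbrandPhi F F E s, ?_⟩, ?_⟩
    · have := strictMonoOn_herbrandPhi F F E hψ hs1 hs
      rwa [herbrandPhi_herbrandPsi F F E hr] at this
    · change w ∈ Weil.ramification F E Ω s at hw
      rw [← herbrandPsi_herbrandPhi F F E hs1, ← Weil.ramification_comap_toBase F E Ω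
        ((bijOn_herbrandPhi F F E).mapsTo hs1)] at hw
      exact hw

end WeilRamification

/-! ### Continuity of the actions on the coefficients -/

section Smoothness

theorem isLocallyConstant_smul_of_isOpen {𝔤 A : Type*} [Group 𝔤] [TopologicalSpace 𝔤]
    [IsTopologicalGroup 𝔤] [Group A] [MulDistribMulAction 𝔤 A] (a : A) (U : Subgroup 𝔤)
    (hU : IsOpen (U : Set 𝔤)) (h : ∀ u ∈ U, u • a = a) :
    IsLocallyConstant fun g : 𝔤 => g • a := by
  rw [IsLocallyConstant.iff_exists_open]
  intro g
  refine ⟨(fun x => g⁻¹ * x) ⁻¹' U, hU.preimage (continuous_const.mul continuous_id), by simp,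
    fun x hx => ?_⟩
  have h1 := congrArg (g • ·) (h _ hx)
  simpa [smul_smul] using h1

theorem Induced.isLocallyConstant_smul {𝔤 𝔥 A : Type*} [Group 𝔤] [TopologicalSpace 𝔤]
    [IsTopologicalGroup 𝔤] [Group 𝔥] [TopologicalSpace 𝔥] {ι : 𝔥 →* 𝔤} [Group A]
    [MulDistribMulAction 𝔥 A] (f : Induced ι A) : IsLocallyConstant fun g : 𝔤 => g • f := by
  obtain ⟨U, hU, h⟩ := f.2.2
  exact isLocallyConstant_smul_of_isOpen f U hU fun u hu => Induced.ext fun x => h x u hu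

theorem IsLAction.isLocallyConstant_smul (F K Ω : Type*) [Field F] [ValuativeRel F] [Field K]
    [Field Ω] [Algebra F K] [Algebra F Ω] [Algebra K Ω] [IsScalarTower F K Ω] {H : Type*}
    [Group H] [RegularFunctions H] [MulDistribMulAction (Weil F K Ω) H] [IsLAction F K Ω H]
    (a : H) : IsLocallyConstant fun w : Weil F K Ω => w • a := by
  obtain ⟨L, hL, h⟩ := IsLAction.finite (F := F) (K := K) (Ω := Ω) (H := H)
  refine isLocallyConstant_smul_of_isOpen a (L.fixingSubgroup.comap (Weil.toGal F K Ω))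
    (L.fixingSubgroup_isOpen.preimage (Weil.continuous_toGal F K Ω)) fun w hw => ?_
  exact h w ((IntermediateField.mem_fixingSubgroup_iff _ _).1 hw) a

end Smoothness

/-! ### Inflation and the Shapiro isomorphism for L-parameters -/

section Depth

variable (F : Type*) [Field F] [ValuativeRel F] [TopologicalSpace F] [IsNonarchimedeanLocalField F]
  (E : Type*) [Field E] [Algebra F E] [FiniteDimensional F E] [IsGalois F E]
  (Ω : Type*) [Field Ω] [Algebra F Ω] [Algebra E Ω] [IsScalarTower F E Ω] [IsSepClosure F Ω]
  (G : Type*) [Group G] [RegularFunctions G]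
  [MulDistribMulAction (Weil F E Ω) G] [IsLAction F E Ω G]

/-- The class of `φ` is inflated from `W_F / W_F^{r+}` if and only if that of `Sh(φ)` is inflated
from `W_E / W_E^{ψ(r)+}`. -/
theorem cohomologyClass_shapiro_mem_range_inflation_iff
    (φ : LParameterClass F F Ω (DualRes F E Ω G)) {r : ℝ} (hr : -1 ≤ r) :
    φ.shapiro.cohomologyClass ∈ Set.range (H1.inflation (A := G)
        (Weil.ramificationPlus F E Ω (herbrandPsi F F E r))) ↔
      φ.cohomologyClass ∈ Set.range (H1.inflation (A := DualRes F E Ω G)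
        (Weil.ramificationPlus F F Ω r)) := by
  have : IsGalois F Ω := inferInstance
  rw [LParameterClass.cohomologyClass_shapiro]
  obtain ⟨α, hα⟩ := Quotient.exists_rep φ.cohomologyClass
  rw [← hα]
  have hopen : IsOpen ((Weil.toBase F E Ω).range : Set (Weil F F Ω)) := by
    rw [MonoidHom.coe_range]
    exact (Weil.isOpenMap_toBase F E Ω).isOpen_range
  refine (mem_range_inflation_iff (IsLAction.isLocallyConstant_smul F E Ω) _
    (α.shapiro (Weil.continuous_toBase F E Ω))).trans (Iff.trans ?_
    (mem_range_inflation_iff Induced.isLocallyConstant_smul _ α).symm)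
  rw [exists_trivialization_iff α (Weil.ramificationPlus F F Ω r)
    (DualRes.evalOne_surjective F E Ω G) hopen (Weil.exists_normal_le F F Ω),
    ← Weil.ramificationPlus_comap_toBase F E Ω hr]
  rfl

end Depth

/-! ### Depth -/

/-- An increasing map from `[0, ∞)` onto itself commutes with infima, also with that of the empty
set, which is `0` by convention. -/
theorem StrictMonoOn.csInf_image_Ici {f g : ℝ → ℝ} (hf : StrictMonoOn f (Set.Ici 0))
    (h0 : f 0 = 0) (hg : ∀ y, 0 ≤ y → 0 ≤ g y ∧ f (g y) = y) {S : Set ℝ} (hS : S ⊆ Set.Ici 0) :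
    sInf (f '' S) = f (sInf S) := by
  rcases S.eq_empty_or_nonempty with rfl | hne
  · simp [h0]
  have hb : BddBelow S := ⟨0, hS⟩
  have hpos : 0 ≤ sInf S := le_csInf hne hS
  refine IsGLB.csInf_eq ⟨?_, fun y hy => ?_⟩ (hne.image f)
  · rintro _ ⟨x, hx, rfl⟩
    exact hf.monotoneOn hpos (hS hx) (csInf_le hb hx)
  · rcases le_total y 0 with h | h
    · exact h.trans (h0 ▸ hf.monotoneOn (Set.mem_Ici.2 le_rfl) hpos hpos)
    · obtain ⟨h1, h2⟩ := hg y h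
      rw [← h2]
      refine hf.monotoneOn h1 hpos (le_csInf hne fun x hx => ?_)
      rw [← hf.le_iff_le h1 (hS hx), h2]
      exact hy ⟨x, hx, rfl⟩

end

theorem theorem2
    (F : Type*) [Field F] [ValuativeRel F] [TopologicalSpace F] [IsNonarchimedeanLocalField F]
    (E : Type*) [Field E] [Algebra F E] [FiniteDimensional F E] [IsGalois F E]
    (Ω : Type*) [Field Ω] [Algebra F Ω] [Algebra E Ω] [IsScalarTower F E Ω]
    [IsSepClosure F Ω]
    (Gdual : Type*) [Group Gdual] [RegularFunctions Gdual] [IsConnectedReductive Gdual]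
    [MulDistribMulAction (Weil F E Ω) Gdual] [IsLAction F E Ω Gdual]
    (φ : LParameterClass F F Ω (DualRes F E Ω Gdual)) :
    φ.shapiro.depth = herbrandPsi F F E φ.depth ∧ (φ.depth = 0 ↔ φ.shapiro.depth = 0) := by
  have hneg : ∀ {r : ℝ}, 0 ≤ r → -1 ≤ r := fun hr => by linarith
  have hmono : StrictMonoOn (herbrandPsi F F E) (Set.Ici 0) :=
    (strictMonoOn_herbrandPsi F F E).mono (Set.Ici_subset_Ici.2 (by norm_num))
  have h0 := herbrandPsi_zero F F E
  have key : φ.shapiro.depth = herbrandPsi F F E φ.depth := by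
    rw [LParameterClass.depth, LParameterClass.depth, ← hmono.csInf_image_Ici h0
      (fun y hy => ⟨herbrandPhi_nonneg F F E hy, herbrandPsi_herbrandPhi F F E (hneg hy)⟩)
      (fun r hr => hr.1)]
    congr 1
    ext s
    constructor
    · rintro ⟨hs, h⟩
      have hφ := herbrandPhi_nonneg F F E hs
      have e := herbrandPsi_herbrandPhi F F E (hneg hs)
      refine ⟨herbrandPhi F F E s, ⟨hφ, ?_⟩, e⟩
      rw [← cohomologyClass_shapiro_mem_range_inflation_iff F E Ω Gdual φ (hneg hφ), e]
      exact h
    · rintro ⟨r, ⟨hr, h⟩, rfl⟩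
      exact ⟨herbrandPsi_nonneg F F E hr,
        (cohomologyClass_shapiro_mem_range_inflation_iff F E Ω Gdual φ (hneg hr)).2 h⟩
  refine ⟨key, ?_⟩
  have hd : 0 ≤ φ.depth := Real.sInf_nonneg fun r hr => hr.1
  rw [key]
  constructor
  · intro h
    rw [h, h0]
  · intro h
    exact hmono.injOn hd (Set.mem_Ici.2 le_rfl) (h.trans h0.symm)
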